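/- Let $K$ be an arbitrary field, and write $M_{n,p}(K)$ for the space of $n\times p$ matrices over $K$; for a linear subspace $S$ of a finite-dimensional vector space $E$, $\operatorname{codim} S := \dim(E/S)$. (1) Matrix form. Let $n \ge p \ge 2$ be integers, let $S$ be a linear subspace of $M_{n,p}(K)$ with $\operatorname{codim} S \le n-2$, and let $N \in M_{n,p}(K)$ satisfy $\operatorname{rk} N < p$ (it is not required that $N \in S$). Then there exists $A \in S$ such that every matrix of the line $A + KN=\{A+\lambda N : \lambda\in K\}$ has rank $p$. (2) Operator form. Let $U$ and $V$ be finite-dimensional $K$-vector spaces with $\dim U \le \dim V$, let $S$ be a linear subspace of the space $\mathcal{L}(U,V)$ of all linear maps from $U$ to $V$ with $\operatorname{codim} S \le \dim V - 2$, and let $t \in \mathcal{L}(U,V)$ be non-injective (it is not required that $t\in S$). Then there exists $a \in S$ such that every operator of $a + Kt$ is injective. (3) Optimality of the bound. For all integers $n \ge p \ge 2$ there exist a linear subspace $S$ of $M_{n,p}(K)$ with $\operatorname{codim} S = n-1$ and a matrix $N \in M_{n,p}(K)$ with $\operatorname{rk} N < p$ such that, for every $A \in S$, some matrix of $A + KN$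 does not have rank $p$. -/

import Mathlib

/-- The codimension of a linear subspace `S` of `E`, that is the dimension of `E ⧸ S`.
It is only used for finite-dimensional `E`. -/
noncomputable def codim (K : Type*) {E : Type*} [Field K] [AddCommGroup E] [Module K E]
    (S : Submodule K E) : ℕ :=
  Module.finrank K (E ⧸ S)

/-! Padding `U` reduces the operator form to dim U = dim V = n. The trace pairing then turns
membership in `S` into equations tr(a ∘ f) = c with c = 0. For an induction on n, nonzero c must be
allowed: the data is a space `T` of pairs (f, c) with dim T + 2 ≤ n.

Compression: take x ≠ 0 in ker t and y ≠ 0 in V, and look for `a` with a x = y. In bases starting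
with x and y, every a + λt is block triangular with corner 1 and lower block a' + λt', so
injectivity passes to the smaller problem. The rest of the first row of `a` is free. It absorbs the
constraints with f y ∉ Kx; the others become constraints on a' (`lineSolvable_of_compress`). A form
b ≠ 0 with b ∘ t = 0 is carried along with the invariant `Compatible`, which keeps the affine system
consistent. A dimension count gives many y that preserve it (`exists_adapted`). The induction
proceeds as soon as there is slack in dim T or a constraint disappears (`Reducing`).

Otherwise f y ∈ Kx for all constraints, all nonzero x ∈ ker t and all admissible y, which is very
rigid. If ker t is a line, the compressed constraints concern only the row b ∘ a', which can be
prescribed directly (`lineSolvable_of_stuck_of_corank_one`). If ker t is larger, all f vanish on the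
range of t (`stuck_structure`), and two successive compressions remove enough constraints
(`lineSolvable_of_stuck`).

The corank-one argument has one gap: n = 3 over the field with two elements. `Unexceptional`
excludes it. This is automatic for c = 0, and `exists_unexceptional` chooses the compression from
dimension 4 to 3 so that the condition holds. -/

open Module Submodule

/-! ### Linear systems and dimension counts -/

section LinearAlgebra

variable {K E F V : Type*} [Field K] [AddCommGroup E] [Module K E] [AddCommGroup F] [Module K F]
  [AddCommGroup V] [Module K V]

/-- A linear form that vanishes on the kernel of a linear map factors through it. -/
theorem exists_factor_of_ker (f : E →ₗ[K] F) (g : E →ₗ[K] K) (h : ∀ e, f e = 0 → g e = 0) :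
    ∃ G : F →ₗ[K] K, ∀ e, G (f e) = g e := by
  have hg : g ∈ LinearMap.range f.dualMap := by
    rw [LinearMap.range_dualMap_eq_dualAnnihilator_ker]
    exact (Submodule.mem_dualAnnihilator g).2 fun e he => h e he
  obtain ⟨G, hG⟩ := hg
  exact ⟨G, fun e => by rw [← hG]; rfl⟩

/-- Solvability of a linear system in the unknown form `G`: the only obstruction is an equation 0 =
c with c ≠ 0. -/
theorem exists_functional_of_consistent (R : Submodule K (F × K))
    (h : ∀ c : K, ((0 : F), c) ∈ R → c = 0) : ∃ G : F →ₗ[K] K, ∀ p ∈ R, G p.1 = p.2 := by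
  obtain ⟨G, hG⟩ := exists_factor_of_ker ((LinearMap.fst K F K).comp R.subtype)
    ((LinearMap.snd K F K).comp R.subtype) (by
      rintro ⟨⟨f, c⟩, hp⟩ h0
      obtain rfl : f = 0 := h0
      exact h c hp)
  exact ⟨G, fun p hp => hG ⟨p, hp⟩⟩

theorem finrank_map_add_finrank_le [FiniteDimensional K E] (f : E →ₗ[K] F) (p q : Submodule K E)
    (hq : q ≤ p) (h : ∀ e ∈ q, f e = 0) : finrank K (p.map f) + finrank K q ≤ finrank K p := by
  have h1 := LinearMap.finrank_range_add_finrank_ker (f.domRestrict p)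
  rw [LinearMap.range_domRestrict] at h1
  have h2 : finrank K q ≤ finrank K (LinearMap.ker (f.domRestrict p)) := by
    refine LinearMap.finrank_le_finrank_of_injective
      (f := LinearMap.codRestrict _ (Submodule.inclusion hq) fun e => ?_) ?_
    · exact h e e.2
    · intro a b hab
      have := congrArg (fun z : LinearMap.ker (f.domRestrict p) => ((z : p) : E)) hab
      exact Subtype.ext this
  omega

theorem finrank_map_add_finrank_eq [FiniteDimensional K E] (f : E →ₗ[K] F) (p : Submodule K E) :
    finrank K (p.map f) + finrank K (p ⊓ LinearMap.ker f : Submodule K E) = finrank K p := by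
  apply le_antisymm
  · exact finrank_map_add_finrank_le f p _ inf_le_left fun e he => he.2
  · have h1 := LinearMap.finrank_range_add_finrank_ker (f.domRestrict p)
    rw [LinearMap.range_domRestrict] at h1
    have h2 : finrank K (LinearMap.ker (f.domRestrict p)) ≤
        finrank K (p ⊓ LinearMap.ker f : Submodule K E) := by
      refine LinearMap.finrank_le_finrank_of_injective
        (f := LinearMap.codRestrict _ (p.subtype.comp (Submodule.subtype _)) fun e => ?_) ?_
      · exact ⟨e.1.2, e.2⟩
      · intro a b hab
        have := congrArg (fun z => ((z : (p ⊓ LinearMap.ker f : Submodule K E)) : E)) hab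
        exact Subtype.ext (Subtype.ext this)
    omega

theorem exists_mem_notMem_of_finrank_lt [FiniteDimensional K E] (p q : Submodule K E)
    (h : finrank K q < finrank K p) : ∃ e ∈ p, e ∉ q := by
  by_contra! hc
  exact absurd (Submodule.finrank_mono (show p ≤ q from hc)) (by omega)

theorem finrank_pos_of_mem_ne_zero [FiniteDimensional K E] {p : Submodule K E} {e : E}
    (he : e ∈ p) (h : e ≠ 0) : 0 < finrank K p :=
  Module.finrank_pos_iff_exists_ne_zero.2 ⟨⟨e, he⟩, fun h0 => h (congrArg Subtype.val h0)⟩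

theorem two_le_finrank_of_pair [FiniteDimensional K E] {p : Submodule K E} {e f : E}
    (he : e ∈ p) (hf : f ∈ p) (h : ∀ c d : K, c • e + d • f = 0 → c = 0 ∧ d = 0) :
    2 ≤ finrank K p := by
  have hli : LinearIndependent K ![(⟨e, he⟩ : p), ⟨f, hf⟩] := by
    rw [LinearIndependent.pair_iff]
    exact fun c d hcd => h c d (congrArg Subtype.val hcd)
  simpa using hli.fintype_card_le_finrank

/-- The common kernel of a family of linear forms is large. -/
theorem finrank_le_add_finrank_common_ker [FiniteDimensional K V] [FiniteDimensional K E]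
    (g : E →ₗ[K] (V →ₗ[K] K)) (p : Submodule K E) :
    ∃ q : Submodule K V, (∀ v, v ∈ q ↔ ∀ e ∈ p, g e v = 0) ∧
      finrank K V ≤ finrank K p + finrank K q := by
  refine ⟨((p.map g).dualCoannihilator), fun v => ?_, ?_⟩
  · rw [Submodule.mem_dualCoannihilator]
    simp
  · have h := Subspace.finrank_add_finrank_dualCoannihilator_eq (p.map g)
    have h2 : finrank K (Submodule.map g p : Submodule K (Dual K V)) ≤ finrank K p :=
      Submodule.finrank_map_le g p
    exact h.symm.le.trans (Nat.add_le_add_right h2 _)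

/-- The solutions of few affine equations are not covered by a small subspace, and any subspace
that contains all solutions outside the small one contains all solutions. -/
theorem exists_solution_notMem [FiniteDimensional K V] (Q : Submodule K ((V →ₗ[K] K) × K))
    (hQ : ∀ c : K, ((0 : V →ₗ[K] K), c) ∈ Q → c = 0) (P : Submodule K V)
    (hPQ : finrank K P + finrank K Q < finrank K V) :
    (∃ y, y ∉ P ∧ ∀ p ∈ Q, p.1 y = p.2) ∧
    ∀ Z : Submodule K V, (∀ y, y ∉ P → (∀ p ∈ Q, p.1 y = p.2) → y ∈ Z) →
      ∀ y, (∀ p ∈ Q, p.1 y = p.2) → y ∈ Z := by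
  obtain ⟨N, hN, hNdim⟩ := finrank_le_add_finrank_common_ker (LinearMap.fst K (V →ₗ[K] K) K) Q
  have hadd : ∀ y, (∀ p ∈ Q, p.1 y = p.2) → ∀ v ∈ N, ∀ p ∈ Q, p.1 (y + v) = p.2 := by
    intro y hy v hv p hp
    rw [map_add, hy p hp, show p.1 v = 0 from (hN v).1 hv p hp, add_zero]
  obtain ⟨v, hvN, hvP⟩ := exists_mem_notMem_of_finrank_lt N P (by omega)
  constructor
  · obtain ⟨G, hG⟩ := exists_functional_of_consistent Q hQ
    obtain ⟨y, hy⟩ : ∃ y : V, ∀ f : V →ₗ[K] K, G f = f y := by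
      refine ⟨(Module.evalEquiv K V).symm G, fun f => ?_⟩
      exact (Module.apply_evalEquiv_symm_apply K V f G).symm
    have hy' : ∀ p ∈ Q, p.1 y = p.2 := fun p hp => by rw [← hy, hG p hp]
    by_cases hyP : y ∈ P
    · exact ⟨y + v, fun h => hvP ((Submodule.add_mem_iff_right P hyP).1 h), hadd y hy' v hvN⟩
    · exact ⟨y, hyP, hy'⟩
  · intro Z hZ y hy
    by_cases hyP : y ∈ P
    swap
    · exact hZ y hyP hy
    have hsum : ∀ w ∈ N, w ∉ P → y + w ∈ Z := fun w hw hwP =>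
      hZ _ (fun h => hwP ((Submodule.add_mem_iff_right P hyP).1 h)) (hadd y hy w hw)
    by_cases hyN : y ∈ N
    · have hv : v ∈ Z := hZ v hvP fun p hp => by
        rw [← hy p hp, show p.1 v = 0 from (hN v).1 hvN p hp,
          show p.1 y = 0 from (hN y).1 hyN p hp]
      exact (Submodule.add_mem_iff_left Z hv).1 (hsum v hvN hvP)
    · have hlt : finrank K (P ⊓ N : Submodule K V) < finrank K P := by
        apply Submodule.finrank_lt_finrank_of_lt
        refine lt_of_le_of_ne inf_le_left fun h => hyN ?_
        rw [← h] at hyP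
        exact hyP.2
      -- `P ⊓ N` has codimension at least two in `N`, so some w makes v, w and v + w all avoid `P`.
      -- This holds even over the field with two elements, and y is then a combination of three
      -- solutions outside `P`.
      have hsp : finrank K (P ⊓ N ⊔ span K {v} : Submodule K V) < finrank K N := by
        have h1 := Submodule.finrank_add_le_finrank_add_finrank (P ⊓ N) (span K {v})
        have h2 := finrank_span_singleton (K := K) (v := v) fun h => hvP (h ▸ P.zero_mem)
        omega
      obtain ⟨w, hwN, hw⟩ := exists_mem_notMem_of_finrank_lt N _ hsp
      have hwP : w ∉ P := fun h => hw (Submodule.mem_sup_left ⟨h, hwN⟩)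
      have hvwP : v + w ∉ P := fun h => hw (by
        have : w = (v + w) + -v := by abel
        rw [this]
        exact Submodule.add_mem_sup ⟨h, N.add_mem hvN hwN⟩
          (neg_mem (Submodule.mem_span_singleton_self v)))
      have h1 := hsum v hvN hvP
      have h2 := hsum w hwN hwP
      have h3 := hsum (v + w) (N.add_mem hvN hwN) hvwP
      have : y = (y + v) + (y + w) - (y + (v + w)) := by abel
      rw [this]
      exact Z.sub_mem (Z.add_mem h1 h2) h3

end LinearAlgebra

/-! ### Compression along x ↦ y, and the problem without constraints -/

section Reduction

variable {K U V : Type*} [Field K] [AddCommGroup U] [Module K U] [AddCommGroup V] [Module K V]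

/-- The trace constraints `T` are satisfied by some `a` such that every operator of the line
`a + K t` is injective. -/
def LineSolvable (T : Submodule K ((V →ₗ[K] U) × K)) (t : U →ₗ[K] V) : Prop :=
  ∃ a : U →ₗ[K] V, (∀ p ∈ T, LinearMap.trace K V (a ∘ₗ p.1) = p.2) ∧
    ∀ c : K, Function.Injective (a + c • t)

/-- The projection on the kernel of the linear form `ξ` along a vector `x` with `ξ x = 1`. -/
def kerProj (ξ : U →ₗ[K] K) (x : U) (h : ξ x = 1) : U →ₗ[K] LinearMap.ker ξ :=
  LinearMap.codRestrict (LinearMap.ker ξ) (LinearMap.id - ξ.smulRight x) fun u => by simp [h]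

theorem kerProj_coe (ξ : U →ₗ[K] K) (x : U) (h : ξ x = 1) (u : U) :
    (kerProj ξ x h u : U) = u - ξ u • x := rfl

theorem kerProj_eq_zero_iff (ξ : U →ₗ[K] K) (x : U) (h : ξ x = 1) (u : U) :
    kerProj ξ x h u = 0 ↔ u ∈ span K {x} := by
  rw [Subtype.ext_iff, kerProj_coe, mem_span_singleton]
  constructor
  · intro h0
    exact ⟨ξ u, (sub_eq_zero.1 h0).symm⟩
  · rintro ⟨c, rfl⟩
    simp [h]

@[simp] theorem kerProj_self (ξ : U →ₗ[K] K) (x : U) (h : ξ x = 1) : kerProj ξ x h x = 0 :=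
  (kerProj_eq_zero_iff ξ x h x).2 (mem_span_singleton_self x)

@[simp] theorem kerProj_coe_ker (ξ : U →ₗ[K] K) (x : U) (h : ξ x = 1) (u : LinearMap.ker ξ) :
    kerProj ξ x h u = u := by
  apply Subtype.ext
  rw [kerProj_coe, LinearMap.mem_ker.1 u.2, zero_smul, sub_zero]

theorem finrank_ker_add_one [FiniteDimensional K U] (ξ : U →ₗ[K] K) (h : ξ ≠ 0) :
    finrank K (LinearMap.ker ξ) + 1 = finrank K U := by
  have h1 := LinearMap.finrank_range_add_finrank_ker ξ
  have h2 : LinearMap.range ξ = ⊤ := LinearMap.range_eq_top.2 (LinearMap.surjective h)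
  rw [h2, finrank_top, finrank_self] at h1
  omega

theorem ne_zero_of_apply_eq_one {ξ : U →ₗ[K] K} {x : U} (h : ξ x = 1) : ξ ≠ 0 := by
  rintro rfl
  simp at h

/-- The compression of an operator to hyperplanes that are complementary to given vectors. -/
def compress (ξ : U →ₗ[K] K) (η : V →ₗ[K] K) (y : V) (hy : η y = 1) (t : U →ₗ[K] V) :
    LinearMap.ker ξ →ₗ[K] LinearMap.ker η :=
  kerProj η y hy ∘ₗ t ∘ₗ (LinearMap.ker ξ).subtype

theorem compress_apply (ξ : U →ₗ[K] K) (η : V →ₗ[K] K) (y : V) (hy : η y = 1) (t : U →ₗ[K] V)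
    (u : LinearMap.ker ξ) : compress ξ η y hy t u = kerProj η y hy (t u) := rfl

/-- Compression of a constraint, when the operator sought maps `x` to `y`. -/
def compressConstraint (ξ : U →ₗ[K] K) (x : U) (hx : ξ x = 1) (η : V →ₗ[K] K) (y : V) :
    ((V →ₗ[K] U) × K) →ₗ[K] ((LinearMap.ker η →ₗ[K] LinearMap.ker ξ) × K) where
  toFun p := (compress η ξ x hx p.1, p.2 - ξ (p.1 y))
  map_add' p q := by
    ext v
    · simp [compress_apply]
    · simp only [Prod.fst_add, Prod.snd_add, LinearMap.add_apply, map_add]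
      ring
  map_smul' c p := by
    ext v
    · simp [compress_apply]
    · simp only [Prod.smul_fst, Prod.smul_snd, LinearMap.smul_apply, map_smul, smul_eq_mul,
        RingHom.id_apply]
      ring

/-- The constraints that map `y` into the line of `x`. -/
def constraintsAt (T : Submodule K ((V →ₗ[K] U) × K)) (x : U) (y : V) :
    Submodule K ((V →ₗ[K] U) × K) :=
  T ⊓ (span K {x}).comap ((LinearMap.applyₗ y).comp (LinearMap.fst K (V →ₗ[K] U) K))

def compressAll (T : Submodule K ((V →ₗ[K] U) × K)) (ξ : U →ₗ[K] K) (x : U) (hx : ξ x = 1)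
    (η : V →ₗ[K] K) (y : V) : Submodule K ((LinearMap.ker η →ₗ[K] LinearMap.ker ξ) × K) :=
  (constraintsAt T x y).map (compressConstraint ξ x hx η y)

theorem mem_compressAll {T : Submodule K ((V →ₗ[K] U) × K)} {ξ : U →ₗ[K] K} {x : U}
    {hx : ξ x = 1} {η : V →ₗ[K] K} {y : V}
    {q : (LinearMap.ker η →ₗ[K] LinearMap.ker ξ) × K} :
    q ∈ compressAll T ξ x hx η y ↔
      ∃ p ∈ T, p.1 y ∈ span K {x} ∧ compress η ξ x hx p.1 = q.1 ∧ p.2 - ξ (p.1 y) = q.2 := by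
  constructor
  · rintro ⟨p, ⟨hp, hpy⟩, rfl⟩
    exact ⟨p, hp, hpy, rfl, rfl⟩
  · rintro ⟨p, hp, hpy, h1, h2⟩
    exact ⟨p, ⟨hp, hpy⟩, Prod.ext h1 h2⟩

/-- The solution has the blocks 1, R, 0, a'. Here tr(a ∘ f) = ξ(f y) + R(proj (f y)) + tr(a' ∘ f'),
so the constraints are a linear system for `R`. Its consistency is exactly what a' satisfies for the
constraints with f y ∈ Kx. -/
theorem lineSolvable_of_compress [FiniteDimensional K U] [FiniteDimensional K V]
    {T : Submodule K ((V →ₗ[K] U) × K)} {t : U →ₗ[K] V} {ξ : U →ₗ[K] K} {x : U} (hx : ξ x = 1)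
    {η : V →ₗ[K] K} {y : V} (hy : η y = 1) (htx : t x = 0)
    (h : LineSolvable (compressAll T ξ x hx η y) (compress ξ η y hy t)) : LineSolvable T t := by
  obtain ⟨a', ha', hinj⟩ := h
  let Φ : ((V →ₗ[K] U) × K) →ₗ[K] (LinearMap.ker ξ × K) :=
    { toFun := fun p => (kerProj ξ x hx (p.1 y), (compressConstraint ξ x hx η y p).2 -
        LinearMap.trace K (LinearMap.ker η) (a' ∘ₗ (compressConstraint ξ x hx η y p).1))
      map_add' := fun p q => by
        ext
        · simp
        · simp only [map_add, Prod.snd_add, Prod.fst_add, LinearMap.comp_add]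
          ring
      map_smul' := fun c p => by
        ext
        · simp
        · simp only [map_smul, Prod.smul_snd, Prod.smul_fst, LinearMap.comp_smul, smul_eq_mul,
            RingHom.id_apply]
          ring }
  obtain ⟨R, hR⟩ := exists_functional_of_consistent (T.map Φ) (by
    rintro c ⟨p, hp, hpc⟩
    have h1 : kerProj ξ x hx (p.1 y) = 0 := congrArg Prod.fst hpc
    have h2 : (compressConstraint ξ x hx η y p).2 - LinearMap.trace K (LinearMap.ker η)
      (a' ∘ₗ (compressConstraint ξ x hx η y p).1) = c := congrArg Prod.snd hpc
    rw [← h2, ha' _ ⟨p, ⟨hp, (kerProj_eq_zero_iff ξ x hx _).1 h1⟩, rfl⟩, sub_self])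
  let ρ : U →ₗ[K] K := ξ + R ∘ₗ kerProj ξ x hx
  refine ⟨ρ.smulRight y + (LinearMap.ker η).subtype ∘ₗ a' ∘ₗ kerProj ξ x hx, fun p hp => ?_,
    fun c => ?_⟩
  · have h1 := hR _ ⟨p, hp, rfl⟩
    change R (kerProj ξ x hx (p.1 y)) = (p.2 - ξ (p.1 y)) - LinearMap.trace K (LinearMap.ker η)
        (a' ∘ₗ compress η ξ x hx p.1) at h1
    have h2 : (ρ.smulRight y) ∘ₗ p.1 = (ρ ∘ₗ p.1).smulRight y := by ext v; rfl
    have h3 : LinearMap.trace K V (((LinearMap.ker η).subtype ∘ₗ a' ∘ₗ kerProj ξ x hx) ∘ₗ p.1) =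
        LinearMap.trace K (LinearMap.ker η) (a' ∘ₗ compress η ξ x hx p.1) := by
      rw [LinearMap.comp_assoc, LinearMap.trace_comp_comm']
      rfl
    rw [LinearMap.add_comp, map_add, h2, LinearMap.trace_smulRight, h3]
    change ξ (p.1 y) + R (kerProj ξ x hx (p.1 y)) + _ = _
    rw [h1]
    ring
  · rw [← LinearMap.ker_eq_bot, LinearMap.ker_eq_bot']
    intro u hu
    change ρ u • y + (a' (kerProj ξ x hx u) : V) + c • t u = 0 at hu
    have hdec : u = ξ u • x + (kerProj ξ x hx u : U) := by rw [kerProj_coe]; abel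
    have htu : t u = t (kerProj ξ x hx u : U) := by
      conv_lhs => rw [hdec]
      rw [map_add, map_smul, htx, smul_zero, zero_add]
    have h1 := congrArg (kerProj η y hy) hu
    simp only [map_add, map_smul, kerProj_self, smul_zero, zero_add, kerProj_coe_ker, map_zero]
      at h1
    have h2 : kerProj ξ x hx u = 0 := by
      apply hinj c
      rw [map_zero, LinearMap.add_apply, LinearMap.smul_apply, compress_apply, ← htu]
      exact h1
    rw [htu, h2] at hu
    have h3 : ρ u = ξ u := by
      change ξ u + R (kerProj ξ x hx u) = _
      rw [h2, map_zero, add_zero]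
    have h4 := congrArg η hu
    simp [h3, hy] at h4
    rw [hdec, h2, h4]
    simp

/-- The base case: there are no constraints. -/
theorem exists_line_injective {n : ℕ} : ∀ {U V : Type*} [AddCommGroup U] [Module K U]
    [AddCommGroup V] [Module K V] [FiniteDimensional K U] [FiniteDimensional K V],
    finrank K U = n + 1 → finrank K V = n + 1 →
    ∀ (t : U →ₗ[K] V) (x : U), x ≠ 0 → t x = 0 →
      ∃ a : U →ₗ[K] V, ∀ c : K, Function.Injective (a + c • t) := by
  induction n with
  | zero =>
    intro U V _ _ _ _ _ _ hU hV t x hx htx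
    have ht : t = 0 := by
      ext u
      obtain ⟨c, rfl⟩ := (finrank_eq_one_iff_of_nonzero' x hx).1 hU u
      simp [htx]
    obtain ⟨e⟩ : Nonempty (U ≃ₗ[K] V) := FiniteDimensional.nonempty_linearEquiv_of_finrank_eq
      (by rw [hU, hV])
    exact ⟨e, fun c => by rw [ht, smul_zero, add_zero]; exact e.injective⟩
  | succ n ih =>
    intro U V _ _ _ _ _ _ hU hV t x hx htx
    obtain ⟨ξ, hξ⟩ := Module.Projective.exists_dual_eq_one K hx
    have hξ' := finrank_ker_add_one ξ (ne_zero_of_apply_eq_one hξ)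
    have hrange : finrank K (LinearMap.range t) ≤ n + 1 := by
      have h1 := LinearMap.finrank_range_add_finrank_ker t
      have h2 : 0 < finrank K (LinearMap.ker t) :=
        Module.finrank_pos_iff_exists_ne_zero.2 ⟨⟨x, htx⟩, fun h => hx (congrArg Subtype.val h)⟩
      omega
    -- The compressed operator needs a kernel again. Any y will do if `t` kills a nonzero vector of
    -- ker ξ; otherwise y = t u is taken, which the projection along y kills.
    obtain ⟨y, hy0, η, hη, x', hx', htx'⟩ : ∃ y : V, y ≠ 0 ∧ ∃ η : V →ₗ[K] K, ∃ h : η y = 1,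
        ∃ x' : LinearMap.ker ξ, x' ≠ 0 ∧ compress ξ η y h t x' = 0 := by
      by_cases hker : ∃ u : LinearMap.ker ξ, u ≠ 0 ∧ t u = 0
      · obtain ⟨u, hu, htu⟩ := hker
        have : Nontrivial V := Module.nontrivial_of_finrank_pos (R := K) (by omega)
        obtain ⟨y, hy⟩ := exists_ne (0 : V)
        obtain ⟨η, hη⟩ := Module.Projective.exists_dual_eq_one K hy
        exact ⟨y, hy, η, hη, u, hu, by rw [compress_apply, htu, map_zero]⟩
      · push Not at hker
        have : Nontrivial (LinearMap.ker ξ) :=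
          Module.nontrivial_of_finrank_pos (R := K) (by omega)
        obtain ⟨u, hu⟩ := exists_ne (0 : LinearMap.ker ξ)
        obtain ⟨η, hη⟩ := Module.Projective.exists_dual_eq_one K (hker u hu)
        exact ⟨t u, hker u hu, η, hη, u, hu, by rw [compress_apply, kerProj_self]⟩
    have hη' := finrank_ker_add_one η (ne_zero_of_apply_eq_one hη)
    obtain ⟨a', ha'⟩ := ih (by omega) (by omega) (compress ξ η y hη t) x' hx' htx'
    obtain ⟨a, -, ha⟩ := lineSolvable_of_compress (T := ⊥) hξ hη htx ⟨a', by
      intro q hq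
      obtain ⟨p, hp, -, h1, h2⟩ := mem_compressAll.1 hq
      obtain rfl : p = 0 := hp
      rw [← h1, ← h2]
      have : compress η ξ x hξ (0 : (V →ₗ[K] U) × K).1 = 0 := by
        ext v; simp [compress_apply]
      rw [this]
      simp, ha'⟩
    exact ⟨a, ha⟩

/-- Operators with a prescribed row that are injective along a line. -/
theorem exists_line_injective_of_row [FiniteDimensional K U] [FiniteDimensional K V]
    (hUV : finrank K U = finrank K V) (t : U →ₗ[K] V) (b : V →ₗ[K] K) (hb : b ≠ 0)
    (hbt : b ∘ₗ t = 0) (ψ : U →ₗ[K] K) (hψ : ψ ≠ 0) (x : U) (hx : x ≠ 0) (htx : t x = 0)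
    (hψx : ψ x = 0) :
    ∃ a : U →ₗ[K] V, b ∘ₗ a = ψ ∧ ∀ c : K, Function.Injective (a + c • t) := by
  obtain ⟨z, hz⟩ : ∃ z, ψ z = 1 := LinearMap.surjective hψ 1
  obtain ⟨w, hw⟩ : ∃ w, b w = 1 := LinearMap.surjective hb 1
  have h1 := finrank_ker_add_one ψ hψ
  have h2 := finrank_ker_add_one b hb
  have hpos : 0 < finrank K (LinearMap.ker ψ) :=
    Module.finrank_pos_iff_exists_ne_zero.2 ⟨⟨x, hψx⟩, fun h => hx (congrArg Subtype.val h)⟩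
  have hbt' : ∀ u, b (t u) = 0 := fun u => LinearMap.congr_fun hbt u
  let t' : LinearMap.ker ψ →ₗ[K] LinearMap.ker b :=
    LinearMap.codRestrict _ (t ∘ₗ (LinearMap.ker ψ).subtype) fun u => hbt' u
  -- Since b ∘ (a + ct) = ψ, a kernel vector of a + ct lies in ker ψ. What remains is the
  -- unconstrained problem from ker ψ to ker b, where `x` is still a kernel vector.
  obtain ⟨a', ha'⟩ := exists_line_injective (n := finrank K (LinearMap.ker ψ) - 1) (by omega)
    (by omega) t' ⟨x, hψx⟩ (fun h => hx (congrArg Subtype.val h)) (Subtype.ext htx)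
  have hrow : ∀ u, b ((ψ.smulRight w + (LinearMap.ker b).subtype ∘ₗ a' ∘ₗ kerProj ψ z hz) u) =
      ψ u := fun u => by
    have : b (a' (kerProj ψ z hz u) : V) = 0 := (a' (kerProj ψ z hz u)).2
    simp [hw, this]
  refine ⟨ψ.smulRight w + (LinearMap.ker b).subtype ∘ₗ a' ∘ₗ kerProj ψ z hz, ?_, fun c => ?_⟩
  · ext u
    exact hrow u
  · rw [← LinearMap.ker_eq_bot, LinearMap.ker_eq_bot']
    intro u hu
    have h3 : ψ u = 0 := by
      have := congrArg b hu
      rw [LinearMap.add_apply, map_add, hrow, LinearMap.smul_apply, map_smul, hbt', smul_zero,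
        add_zero, map_zero] at this
      exact this
    have h4 : (⟨u, h3⟩ : LinearMap.ker ψ) = 0 := by
      apply ha' c
      rw [map_zero]
      apply Subtype.ext
      have h5 : kerProj ψ z hz u = ⟨u, h3⟩ := kerProj_coe_ker ψ z hz ⟨u, h3⟩
      change ψ u • w + (a' (kerProj ψ z hz u) : V) + c • t u = 0 at hu
      rw [h3, zero_smul, zero_add, h5] at hu
      exact hu
    exact congrArg Subtype.val h4

end Reduction

/-! ### The choice of y and the invariants kept by compression -/

section Adapted

variable {K U V : Type*} [Field K] [AddCommGroup U] [Module K U] [AddCommGroup V] [Module K V]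

/-- The constraints whose operator maps the kernel of `b` into the line of `x`. -/
def lineConstraints (T : Submodule K ((V →ₗ[K] U) × K)) (b : V →ₗ[K] K) (x : U) :
    Submodule K ((V →ₗ[K] U) × K) where
  carrier := {p | p ∈ T ∧ ∀ w, b w = 0 → p.1 w ∈ span K {x}}
  add_mem' hp hq := ⟨T.add_mem hp.1 hq.1, fun w hw => add_mem (hp.2 w hw) (hq.2 w hw)⟩
  zero_mem' := ⟨T.zero_mem, fun _ _ => zero_mem _⟩
  smul_mem' c _ hp := ⟨T.smul_mem c hp.1, fun w hw => smul_mem _ c (hp.2 w hw)⟩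

/-- The constraints of `lineConstraints` whose operator has its range in the kernel of `t`. -/
def kerLineConstraints (T : Submodule K ((V →ₗ[K] U) × K)) (t : U →ₗ[K] V) (b : V →ₗ[K] K)
    (x : U) : Submodule K ((V →ₗ[K] U) × K) where
  carrier := {p | p ∈ lineConstraints T b x ∧ ∀ v, t (p.1 v) = 0}
  add_mem' hp hq := ⟨add_mem hp.1 hq.1, fun v => by
    rw [Prod.fst_add, LinearMap.add_apply, map_add, hp.2, hq.2, add_zero]⟩
  zero_mem' := ⟨zero_mem _, fun _ => map_zero t⟩
  smul_mem' c p hp := ⟨smul_mem _ c hp.1, fun v => by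
    rw [Prod.smul_fst, LinearMap.smul_apply, map_smul, hp.2, smul_zero]⟩

/-- The constraints whose operator has its range in the line of `x`. -/
def rangeConstraints (T : Submodule K ((V →ₗ[K] U) × K)) (x : U) :
    Submodule K ((V →ₗ[K] U) × K) where
  carrier := {p | p ∈ T ∧ ∀ v, p.1 v ∈ span K {x}}
  add_mem' hp hq := ⟨T.add_mem hp.1 hq.1, fun v => add_mem (hp.2 v) (hq.2 v)⟩
  zero_mem' := ⟨T.zero_mem, fun _ => zero_mem _⟩
  smul_mem' c _ hp := ⟨T.smul_mem c hp.1, fun v => smul_mem _ c (hp.2 v)⟩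

/-- The constraints whose operator vanishes on the kernel of `b` and has its range in the kernel
of `t`. -/
def cornerConstraints (T : Submodule K ((V →ₗ[K] U) × K)) (t : U →ₗ[K] V) (b : V →ₗ[K] K) :
    Submodule K ((V →ₗ[K] U) × K) where
  carrier := {p | p ∈ T ∧ (∀ w, b w = 0 → p.1 w = 0) ∧ ∀ v, t (p.1 v) = 0}
  add_mem' hp hq := ⟨T.add_mem hp.1 hq.1, fun w hw => by
    rw [Prod.fst_add, LinearMap.add_apply, hp.2.1 w hw, hq.2.1 w hw, add_zero], fun v => by
    rw [Prod.fst_add, LinearMap.add_apply, map_add, hp.2.2, hq.2.2, add_zero]⟩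
  zero_mem' := ⟨T.zero_mem, fun _ _ => rfl, fun _ => map_zero t⟩
  smul_mem' c p hp := ⟨T.smul_mem c hp.1, fun w hw => by
    rw [Prod.smul_fst, LinearMap.smul_apply, hp.2.1 w hw, smul_zero], fun v => by
    rw [Prod.smul_fst, LinearMap.smul_apply, map_smul, hp.2.2, smul_zero]⟩

/-- The constraints do not prevent that `b ∘ a` vanishes on the kernel of `t`. -/
def Compatible (T : Submodule K ((V →ₗ[K] U) × K)) (t : U →ₗ[K] V) (b : V →ₗ[K] K) : Prop :=
  ∀ p ∈ cornerConstraints T t b, p.2 = 0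

/-- The first compatibility conditions on a value `y` to be taken at `x`. -/
def Admissible (T : Submodule K ((V →ₗ[K] U) × K)) (t : U →ₗ[K] V) (b : V →ₗ[K] K) (x : U)
    (y : V) : Prop :=
  b y = 0 ∧ ∀ p ∈ kerLineConstraints T t b x, p.1 y = p.2 • x

/-- The conditions on `y` under which compatibility survives the compression that is given by
`x ↦ y`. -/
def Adapted (T : Submodule K ((V →ₗ[K] U) × K)) (t : U →ₗ[K] V) (b : V →ₗ[K] K) (x : U)
    (y : V) : Prop :=
  y ≠ 0 ∧ b y = 0 ∧
    ∀ p ∈ lineConstraints T b x, (∀ v, t (p.1 v) ∈ span K {y}) → p.1 y = p.2 • x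

/-- A condition that matters only for spaces of dimension three over the field with two elements. -/
def Unexceptional (T : Submodule K ((V →ₗ[K] U) × K)) (t : U →ₗ[K] V) (b : V →ₗ[K] K) : Prop :=
  ∀ x, x ≠ 0 → t x = 0 → ∀ p ∈ lineConstraints T b x, (∃ v, t (p.1 v) ≠ 0) →
    (∀ v, p.1 (t (p.1 v)) = 0) → p.2 ≠ 0 → ∀ u, p.1 (t u) = 0

theorem Adapted.admissible {T : Submodule K ((V →ₗ[K] U) × K)} {t : U →ₗ[K] V}
    {b : V →ₗ[K] K} {x : U} {y : V} (h : Adapted T t b x y) : Admissible T t b x y :=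
  ⟨h.2.1, fun p hp => h.2.2 p hp.1 fun v => by rw [hp.2]; exact zero_mem _⟩

theorem rangeConstraints_le_lineConstraints (T : Submodule K ((V →ₗ[K] U) × K))
    (b : V →ₗ[K] K) (x : U) : rangeConstraints T x ≤ lineConstraints T b x :=
  fun _ hp => ⟨hp.1, fun w _ => hp.2 w⟩

theorem map_eq_zero_of_mem_span {t : U →ₗ[K] V} {x u : U} (htx : t x = 0)
    (hu : u ∈ span K {x}) : t u = 0 := by
  obtain ⟨c, rfl⟩ := mem_span_singleton.1 hu
  rw [map_smul, htx, smul_zero]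

theorem cornerConstraints_le_kerLineConstraints (T : Submodule K ((V →ₗ[K] U) × K))
    (t : U →ₗ[K] V) (b : V →ₗ[K] K) (x : U) :
    cornerConstraints T t b ≤ kerLineConstraints T t b x :=
  fun p hp => ⟨⟨hp.1, fun w hw => by rw [hp.2.1 w hw]; exact zero_mem _⟩, hp.2.2⟩

/-- For a constraint of `lineConstraints` the values of `t ∘ p.1` are multiples of one of them. -/
theorem apply_lineConstraint {T : Submodule K ((V →ₗ[K] U) × K)} {t : U →ₗ[K] V}
    {b : V →ₗ[K] K} {x : U} (htx : t x = 0) {w₁ : V} (hw₁ : b w₁ = 1) {p : (V →ₗ[K] U) × K}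
    (hp : p ∈ lineConstraints T b x) (v : V) : t (p.1 v) = b v • t (p.1 w₁) := by
  have h := map_eq_zero_of_mem_span htx (hp.2 (v - b v • w₁) (by simp [hw₁]))
  rw [map_sub, map_sub, map_smul, map_smul, sub_eq_zero] at h
  exact h

section Selection

variable [FiniteDimensional K U] [FiniteDimensional K V]

/-- In ker b, of dimension dim V - 1, the adapted y include all solutions of an affine system (from
`kerLineConstraints`) outside a subspace (the values of t ∘ f for `lineConstraints`). The two
dimensions add up to at most dim T minus that of `cornerConstraints`, so `exists_solution_notMem`
applies. The second claim transfers linear conditions from adapted to admissible vectors. -/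
theorem exists_adapted {T : Submodule K ((V →ₗ[K] U) × K)} {t : U →ₗ[K] V} {b : V →ₗ[K] K}
    (hb : b ≠ 0) (hbt : ∀ u, b (t u) = 0) {x : U} (hx : x ≠ 0) (htx : t x = 0)
    (hT : Compatible T t b)
    (hdim : finrank K T + 2 ≤ finrank K V + finrank K (cornerConstraints T t b)) :
    (∃ y, Adapted T t b x y) ∧
      ∀ Z : Submodule K V, (∀ y, Adapted T t b x y → y ∈ Z) →
        ∀ y, Admissible T t b x y → y ∈ Z := by
  obtain ⟨w₁, hw₁⟩ : ∃ w, b w = 1 := LinearMap.surjective hb 1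
  obtain ⟨ξ, hξ⟩ := Module.Projective.exists_dual_eq_one K hx
  have hW := finrank_ker_add_one b hb
  let τ : ((V →ₗ[K] U) × K) →ₗ[K] LinearMap.ker b :=
    (LinearMap.codRestrict (LinearMap.ker b) t hbt).comp
      ((LinearMap.applyₗ w₁).comp (LinearMap.fst K (V →ₗ[K] U) K))
  have hτ : ∀ p, (τ p : V) = t (p.1 w₁) := fun p => rfl
  let θ : ((V →ₗ[K] U) × K) →ₗ[K] ((LinearMap.ker b →ₗ[K] K) × K) :=
    { toFun := fun p => (ξ ∘ₗ p.1 ∘ₗ (LinearMap.ker b).subtype, p.2)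
      map_add' := fun p q => by ext <;> simp
      map_smul' := fun c p => by ext <;> simp }
  have hker : ∀ p ∈ lineConstraints T b x, t (p.1 w₁) = 0 → p ∈ kerLineConstraints T t b x :=
    fun p hp h => ⟨hp, fun v => by rw [apply_lineConstraint htx hw₁ hp, h, smul_zero]⟩
  have hPdim := finrank_map_add_finrank_eq τ (lineConstraints T b x)
  have hPker : lineConstraints T b x ⊓ LinearMap.ker τ = kerLineConstraints T t b x := by
    ext p
    constructor
    · rintro ⟨h1, h2⟩
      exact hker p h1 (congrArg Subtype.val (LinearMap.mem_ker.1 h2))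
    · intro hp
      exact ⟨hp.1, LinearMap.mem_ker.2 (Subtype.ext (hp.2 w₁))⟩
  -- By compatibility, corner constraints impose nothing on y; this is where their dimension is
  -- gained.
  have hQdim := finrank_map_add_finrank_le θ (kerLineConstraints T t b x)
    (cornerConstraints T t b) (cornerConstraints_le_kerLineConstraints T t b x) (by
      intro p hp
      refine Prod.ext (LinearMap.ext fun w => ?_) (hT p hp)
      change ξ (p.1 w) = 0
      rw [hp.2.1 w w.2, map_zero])
  have hle : finrank K (lineConstraints T b x) ≤ finrank K T :=
    Submodule.finrank_mono fun p hp => hp.1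
  rw [hPker] at hPdim
  obtain ⟨h1, h2⟩ := exists_solution_notMem ((kerLineConstraints T t b x).map θ) (by
    rintro c ⟨p, hp, hpc⟩
    have hc : p.2 = c := congrArg Prod.snd hpc
    rw [← hc]
    refine hT p ⟨hp.1.1, fun w hw => ?_, hp.2⟩
    have h3 : ξ (p.1 w) = 0 := LinearMap.congr_fun (congrArg Prod.fst hpc) ⟨w, hw⟩
    obtain ⟨s, hs⟩ := mem_span_singleton.1 (hp.1.2 w hw)
    rw [← hs, map_smul, hξ, smul_eq_mul, mul_one] at h3
    rw [← hs, h3, zero_smul]) ((lineConstraints T b x).map τ) (by omega)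
  have hsol : ∀ y : LinearMap.ker b, (∀ q ∈ (kerLineConstraints T t b x).map θ, q.1 y = q.2) →
      Admissible T t b x y := by
    refine fun y hy => ⟨y.2, fun p hp => ?_⟩
    have h3 : ξ (p.1 y) = p.2 := hy _ ⟨p, hp, rfl⟩
    obtain ⟨s, hs⟩ := mem_span_singleton.1 (hp.1.2 y y.2)
    rw [← hs, map_smul, hξ, smul_eq_mul, mul_one] at h3
    rw [← hs, h3]
  have hadapted : ∀ y : LinearMap.ker b, y ∉ (lineConstraints T b x).map τ →
      (∀ q ∈ (kerLineConstraints T t b x).map θ, q.1 y = q.2) → Adapted T t b x y := by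
    intro y hyP hy
    refine ⟨fun h => hyP ?_, y.2, fun p hp hpy => ?_⟩
    · rw [show y = 0 from Subtype.ext h]
      exact zero_mem _
    · obtain ⟨s, hs⟩ := mem_span_singleton.1 (hpy w₁)
      have hs0 : s = 0 := by
        by_contra hs0
        refine hyP ⟨s⁻¹ • p, smul_mem _ _ hp, Subtype.ext ?_⟩
        rw [hτ, Prod.smul_fst, LinearMap.smul_apply, map_smul, ← hs, smul_smul,
          inv_mul_cancel₀ hs0, one_smul]
      exact (hsol y hy).2 p (hker p hp (by rw [← hs, hs0, zero_smul]))
  constructor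
  · obtain ⟨y, hyP, hy⟩ := h1
    exact ⟨y, hadapted y hyP hy⟩
  · intro Z hZ y hy
    refine h2 (Z.comap (LinearMap.ker b).subtype) (fun y hyP hy => hZ y (hadapted y hyP hy))
      ⟨y, hy.1⟩ ?_
    rintro _ ⟨p, hp, rfl⟩
    change ξ (p.1 y) = p.2
    rw [hy.2 p hp, map_smul, hξ, smul_eq_mul, mul_one]

end Selection

section Transfer

variable {T : Submodule K ((V →ₗ[K] U) × K)} {t : U →ₗ[K] V} {b : V →ₗ[K] K} {x : U} {y : V}
  {ξ : U →ₗ[K] K} {η : V →ₗ[K] K}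

theorem comp_subtype_ker_ne_zero (hb : b ≠ 0) (hy : η y = 1) (hby : b y = 0) :
    b ∘ₗ (LinearMap.ker η).subtype ≠ 0 := by
  intro h
  refine hb (LinearMap.ext fun v => ?_)
  have h1 : b (kerProj η y hy v : V) = 0 := LinearMap.congr_fun h (kerProj η y hy v)
  rw [kerProj_coe, map_sub, map_smul, hby, smul_zero, sub_zero] at h1
  exact h1

theorem comp_subtype_compress (hbt : ∀ u, b (t u) = 0) (hy : η y = 1) (hby : b y = 0)
    (u : LinearMap.ker ξ) :
    (b ∘ₗ (LinearMap.ker η).subtype) (compress ξ η y hy t u) = 0 := by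
  change b (kerProj η y hy (t u) : V) = 0
  rw [kerProj_coe, map_sub, map_smul, hby, hbt, smul_zero, sub_zero]

theorem map_kerProj (hx : ξ x = 1) (htx : t x = 0) (u : U) : t (kerProj ξ x hx u : U) = t u := by
  rw [kerProj_coe, map_sub, map_smul, htx, smul_zero, sub_zero]

theorem compress_compress_apply (hx : ξ x = 1) (hy : η y = 1) (htx : t x = 0) (f : V →ₗ[K] U)
    (v : LinearMap.ker η) :
    compress ξ η y hy t (compress η ξ x hx f v) = kerProj η y hy (t (f v)) := by
  rw [compress_apply, compress_apply, map_kerProj hx htx]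

theorem compress_kerProj (hx : ξ x = 1) (hy : η y = 1) {f : V →ₗ[K] U}
    (hfy : f y ∈ span K {x}) (v : V) :
    compress η ξ x hx f (kerProj η y hy v) = kerProj ξ x hx (f v) := by
  rw [compress_apply, kerProj_coe, map_sub, map_smul, map_sub, map_smul,
    (kerProj_eq_zero_iff ξ x hx _).2 hfy, smul_zero, sub_zero]

/-- A corner constraint of the compressed problem comes from some (f, c) with f(ker b) ⊆ Kx and t ∘
f valued in Ky. For these, `Adapted` says f y = c x, which makes the compressed value c - ξ(f y)
vanish. -/
theorem Adapted.compatible_compress (h : Adapted T t b x y) (hx : ξ x = 1) (hy : η y = 1)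
    (htx : t x = 0) : Compatible (compressAll T ξ x hx η y) (compress ξ η y hy t)
      (b ∘ₗ (LinearMap.ker η).subtype) := by
  rintro q ⟨hq, hq1, hq2⟩
  obtain ⟨p, hp, hpy, h1, h2⟩ := mem_compressAll.1 hq
  have hpl : p ∈ lineConstraints T b x := by
    refine ⟨hp, fun w hw => ?_⟩
    have h3 := hq1 (kerProj η y hy w) (by
      change b (kerProj η y hy w : V) = 0
      rw [kerProj_coe, map_sub, map_smul, hw, h.2.1, smul_zero, sub_zero])
    rw [← h1, compress_kerProj hx hy hpy] at h3
    exact (kerProj_eq_zero_iff ξ x hx _).1 h3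
  have h4 := h.2.2 p hpl fun v => by
    have h3 := hq2 (kerProj η y hy v)
    rw [← h1, compress_kerProj hx hy hpy, compress_apply, map_kerProj hx htx] at h3
    exact (kerProj_eq_zero_iff η y hy _).1 h3
  rw [← h2, h4, map_smul, hx, smul_eq_mul, mul_one, sub_self]

/-- Constraints with range in Kx compress to the zero operator, and adaptedness makes their new
value zero too. -/
theorem Adapted.finrank_compressAll_add_le [FiniteDimensional K U] [FiniteDimensional K V]
    (h : Adapted T t b x y) (hx : ξ x = 1) (htx : t x = 0) :
    finrank K (compressAll T ξ x hx η y) + finrank K (rangeConstraints T x) ≤ finrank K T := by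
  have h1 := finrank_map_add_finrank_le (compressConstraint ξ x hx η y) (constraintsAt T x y)
    (rangeConstraints T x) (fun p hp => ⟨hp.1, hp.2 y⟩) (fun p hp => by
      refine Prod.ext (LinearMap.ext fun v => ?_) ?_
      · exact (kerProj_eq_zero_iff ξ x hx _).2 (hp.2 v)
      · have h4 := h.2.2 p (rangeConstraints_le_lineConstraints T b x hp) fun v => by
          rw [map_eq_zero_of_mem_span htx (hp.2 v)]
          exact zero_mem _
        change p.2 - ξ (p.1 y) = 0
        rw [h4, map_smul, hx, smul_eq_mul, mul_one, sub_self])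
  have h2 : finrank K (constraintsAt T x y) ≤ finrank K T := Submodule.finrank_mono inf_le_left
  exact h1.trans h2

/-- A constraint with f y ∉ Kx is absorbed by the free row and does not enter the compressed system.
-/
theorem finrank_compressAll_lt [FiniteDimensional K U] [FiniteDimensional K V] (hx : ξ x = 1)
    {p : (V →ₗ[K] U) × K} (hp : p ∈ T) (hpy : p.1 y ∉ span K {x}) :
    finrank K (compressAll T ξ x hx η y) < finrank K T := by
  have h1 : finrank K (compressAll T ξ x hx η y) ≤ finrank K (constraintsAt T x y) :=
    Submodule.finrank_map_le _ _
  refine lt_of_le_of_lt h1 (Submodule.finrank_lt_finrank_of_lt ?_)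
  exact lt_of_le_of_ne inf_le_left fun h => hpy (h.symm ▸ hp : p ∈ constraintsAt T x y).2

theorem compressAll_comp_eq_zero (h : ∀ p ∈ T, ∀ u, p.1 (t u) = 0) (hx : ξ x = 1) (hy : η y = 1) :
    ∀ q ∈ compressAll T ξ x hx η y, ∀ u, q.1 (compress ξ η y hy t u) = 0 := by
  intro q hq u
  obtain ⟨p, hp, hpy, h1, h2⟩ := mem_compressAll.1 hq
  rw [← h1, compress_apply ξ, compress_kerProj hx hy hpy, h p hp, map_zero]

theorem unexceptional_of_comp_eq_zero (h : ∀ p ∈ T, ∀ u, p.1 (t u) = 0) : Unexceptional T t b :=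
  fun _ _ _ p hp _ _ _ u => h p hp.1 u

/-- The obstruction to the compressed problem being unexceptional. -/
def ExceptionalAt (T : Submodule K ((V →ₗ[K] U) × K)) (t : U →ₗ[K] V) (b : V →ₗ[K] K) (x : U)
    (y : V) : Prop :=
  ∃ x' ∉ span K {x}, t x' ∈ span K {y} ∧ ∃ p ∈ T, p.1 y ∈ span K {x} ∧
    (∀ w, b w = 0 → p.1 w ∈ span K {x, x'}) ∧ (∃ v, t (p.1 v) ∉ span K {y}) ∧
    (∀ v, p.1 (t (p.1 v)) ∈ span K {x}) ∧ ∃ u, p.1 (t u) ∉ span K {x}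

theorem unexceptional_compress (hby : b y = 0) (h : ¬ ExceptionalAt T t b x y) (hx : ξ x = 1)
    (hy : η y = 1) (htx : t x = 0) :
    Unexceptional (compressAll T ξ x hx η y) (compress ξ η y hy t)
      (b ∘ₗ (LinearMap.ker η).subtype) := by
  rintro x' hx' htx' q ⟨hq, hq1⟩ ⟨v, hv⟩ hqq - u
  by_contra hu
  obtain ⟨p, hp, hpy, h1, h2⟩ := mem_compressAll.1 hq
  refine h ⟨x', fun hmem => hx' ?_, ?_, p, hp, hpy, fun w hw => ?_, ⟨v, fun hmem => hv ?_⟩,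
    fun w => ?_, ⟨u, fun hmem => hu ?_⟩⟩
  · rw [← kerProj_coe_ker ξ x hx x']
    exact (kerProj_eq_zero_iff ξ x hx _).2 hmem
  · exact (kerProj_eq_zero_iff η y hy _).1 htx'
  · have h3 := hq1 (kerProj η y hy w) (by
      change b (kerProj η y hy w : V) = 0
      rw [kerProj_coe, map_sub, map_smul, hw, hby, smul_zero, sub_zero])
    rw [← h1, compress_kerProj hx hy hpy] at h3
    obtain ⟨s, hs⟩ := mem_span_singleton.1 h3
    rw [mem_span_pair]
    refine ⟨ξ (p.1 w), s, ?_⟩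
    have h4 := congrArg Subtype.val hs
    rw [kerProj_coe] at h4
    change s • (x' : U) = _ at h4
    rw [h4]
    abel
  · rw [← h1, compress_compress_apply hx hy htx]
    exact (kerProj_eq_zero_iff η y hy _).2 hmem
  · have h3 := hqq (kerProj η y hy w)
    rw [← h1, compress_kerProj hx hy hpy, compress_apply ξ, map_kerProj hx htx,
      compress_kerProj hx hy hpy] at h3
    exact (kerProj_eq_zero_iff ξ x hx _).1 h3
  · rw [← h1, compress_apply ξ, compress_kerProj hx hy hpy]
    exact (kerProj_eq_zero_iff ξ x hx _).2 hmem

end Transfer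

end Adapted

/-! ### One step of the induction -/

section Step

universe u v w

/-- The statement proved by induction on the dimension `n`. -/
def SolvableInDim (K : Type w) [Field K] (n : ℕ) : Prop :=
  ∀ (U : Type u) (V : Type v) [AddCommGroup U] [Module K U] [FiniteDimensional K U]
    [AddCommGroup V] [Module K V] [FiniteDimensional K V],
    finrank K U = n → finrank K V = n → ∀ (T : Submodule K ((V →ₗ[K] U) × K)) (t : U →ₗ[K] V)
      (b : V →ₗ[K] K), b ≠ 0 → (∀ u, b (t u) = 0) → Compatible T t b → finrank K T + 2 ≤ n →
      (n = 3 → (∀ s : K, s ≠ 0 → s = 1) → Unexceptional T t b) → LineSolvable T t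

variable {K : Type w} {U : Type u} {V : Type v} [Field K] [AddCommGroup U] [Module K U] [AddCommGroup V] [Module K V]
  [FiniteDimensional K U] [FiniteDimensional K V]
  {T : Submodule K ((V →ₗ[K] U) × K)} {t : U →ₗ[K] V} {b : V →ₗ[K] K} {x : U} {y : V}

/-- The compression given by `x ↦ y` removes sufficiently many constraints. -/
def Reducing (T : Submodule K ((V →ₗ[K] U) × K)) (x : U) (y : V) : Prop :=
  finrank K T + 3 ≤ finrank K V ∨
    finrank K T + 2 ≤ finrank K V ∧ (rangeConstraints T x ≠ ⊥ ∨ ∃ p ∈ T, p.1 y ∉ span K {x})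

theorem lineSolvable_of_adapted {n : ℕ} (ih : SolvableInDim.{u, v, w} K n) (hU : finrank K U = n + 1)
    (hV : finrank K V = n + 1) (hb : b ≠ 0) (hbt : ∀ u, b (t u) = 0) (hx : x ≠ 0)
    (htx : t x = 0) (h : Adapted T t b x y) (hred : Reducing T x y)
    (hexc : n = 3 → (∀ s : K, s ≠ 0 → s = 1) → ¬ ExceptionalAt T t b x y) :
    LineSolvable T t := by
  obtain ⟨ξ, hξ⟩ := Module.Projective.exists_dual_eq_one K hx
  obtain ⟨η, hη⟩ := Module.Projective.exists_dual_eq_one K h.1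
  have hξ' := finrank_ker_add_one ξ (ne_zero_of_apply_eq_one hξ)
  have hη' := finrank_ker_add_one η (ne_zero_of_apply_eq_one hη)
  refine lineSolvable_of_compress hξ hη htx (ih (LinearMap.ker ξ) (LinearMap.ker η) (by omega) (by omega) _ _ _
    (comp_subtype_ker_ne_zero hb hη h.2.1) (comp_subtype_compress hbt hη h.2.1)
    (h.compatible_compress hξ hη htx) ?_ fun h3 hK =>
    unexceptional_compress h.2.1 (hexc h3 hK) hξ hη htx)
  have h1 := h.finrank_compressAll_add_le hξ htx (η := η)
  rcases hred with h2 | ⟨h2, h3 | ⟨p, hp, hpy⟩⟩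
  · omega
  · have : 0 < finrank K (rangeConstraints T x) :=
      Nat.pos_of_ne_zero fun h0 => h3 (Submodule.finrank_eq_zero.1 h0)
    omega
  · have := finrank_compressAll_lt (η := η) hξ hp hpy
    omega

end Step

/-! ### The stuck case with one-dimensional kernel -/

section Corank

variable {K U V : Type*} [Field K] [AddCommGroup U] [Module K U] [AddCommGroup V] [Module K V]
  [FiniteDimensional K U] [FiniteDimensional K V]
  {T : Submodule K ((V →ₗ[K] U) × K)} {t : U →ₗ[K] V} {b : V →ₗ[K] K} {x : U} {y : V}

/-- As f(ker b) ⊆ Kx, every compressed constraint is a tensor of b with proj (f w₀), whose trace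
against a' sees only the row ψ = b ∘ a'. Choosing y = t u makes proj u a kernel vector of the
compressed operator, as `exists_line_injective_of_row` needs. -/
theorem lineSolvable_of_row (hUV : finrank K U = finrank K V) (hb : b ≠ 0)
    (hbt : ∀ u, b (t u) = 0) (hline : ∀ p ∈ T, ∀ w, b w = 0 → p.1 w ∈ span K {x})
    {ξ : U →ₗ[K] K} (hξ : ξ x = 1) (htx : t x = 0) (hy : y ≠ 0) (hby : b y = 0) {w₀ : V}
    (hw₀ : b w₀ = 1) (ψ : LinearMap.ker ξ →ₗ[K] K) (hψ : ψ ≠ 0)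
    (hψT : ∀ p ∈ T, ψ (kerProj ξ x hξ (p.1 w₀)) = p.2 - ξ (p.1 y)) (u : U) (hu : t u = y)
    (hψu : ψ (kerProj ξ x hξ u) = 0) : LineSolvable T t := by
  obtain ⟨η, hη⟩ := Module.Projective.exists_dual_eq_one K hy
  have hξ' := finrank_ker_add_one ξ (ne_zero_of_apply_eq_one hξ)
  have hη' := finrank_ker_add_one η (ne_zero_of_apply_eq_one hη)
  have hu0 : kerProj ξ x hξ u ≠ 0 := fun h0 => hy (by
    rw [← hu, map_eq_zero_of_mem_span htx ((kerProj_eq_zero_iff ξ x hξ u).1 h0)])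
  obtain ⟨a, ha1, ha2⟩ := exists_line_injective_of_row (by omega) (compress ξ η y hη t)
    (b ∘ₗ (LinearMap.ker η).subtype) (comp_subtype_ker_ne_zero hb hη hby)
    (LinearMap.ext (comp_subtype_compress hbt hη hby)) ψ hψ (kerProj ξ x hξ u) hu0
    (by rw [compress_apply, map_kerProj hξ htx, hu, kerProj_self]) hψu
  refine lineSolvable_of_compress hξ hη htx ⟨a, fun q hq => ?_, ha2⟩
  obtain ⟨p, hp, -, h1, h2⟩ := mem_compressAll.1 hq
  have h3 : a ∘ₗ q.1 =
      (b ∘ₗ (LinearMap.ker η).subtype).smulRight (a (kerProj ξ x hξ (p.1 w₀))) := by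
    ext v : 1
    rw [← h1, LinearMap.comp_apply, compress_apply, LinearMap.smulRight_apply, ← map_smul,
      ← map_smul]
    congr 1
    rw [← sub_eq_zero, ← map_sub, kerProj_eq_zero_iff, ← map_smul, ← map_sub]
    exact hline p hp _ (by simp [hw₀])
  rw [h3, LinearMap.trace_smulRight, ← h2, ← hψT p hp, ← ha1]
  rfl

/-- It remains to find y and a row ψ ≠ 0 for `lineSolvable_of_row`. Modulo Kx, `t` identifies U with
ker b, so the prescribed values of ψ live on the proper subspace H = `T.map τ` of ker b, and ψ can
be chosen freely at one further vector. -/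
theorem lineSolvable_of_stuck_of_corank_one (hUV : finrank K U = finrank K V) (hb : b ≠ 0)
    (hbt : ∀ u, b (t u) = 0) (hx : x ≠ 0) (hker : ∀ u, t u = 0 ↔ u ∈ span K {x})
    (hline : ∀ p ∈ T, ∀ w, b w = 0 → p.1 w ∈ span K {x})
    (hrange : rangeConstraints T x = ⊥) (hdim : finrank K T + 2 = finrank K V) (hT : T ≠ ⊥)
    (hexc : finrank K V = 3 → (∀ s : K, s ≠ 0 → s = 1) → Unexceptional T t b) :
    LineSolvable T t := by
  obtain ⟨ξ, hξ⟩ := Module.Projective.exists_dual_eq_one K hx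
  obtain ⟨w₀, hw₀⟩ : ∃ w, b w = 1 := LinearMap.surjective hb 1
  have htx : t x = 0 := (hker x).2 (mem_span_singleton_self x)
  have hbW := finrank_ker_add_one b hb
  have hkerx : LinearMap.ker t = span K {x} := by
    ext u
    exact hker u
  have hranget : LinearMap.range t = LinearMap.ker b := by
    apply Submodule.eq_of_le_of_finrank_eq
    · rintro _ ⟨u, rfl⟩
      exact hbt u
    · have h1 := LinearMap.finrank_range_add_finrank_ker t
      rw [hkerx, finrank_span_singleton hx] at h1
      omega
  have hzero : ∀ p ∈ T, t (p.1 w₀) = 0 → p = 0 := by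
    intro p hp h0
    have : p ∈ rangeConstraints T x := by
      refine ⟨hp, fun v => ?_⟩
      have h1 := hline p hp (v - b v • w₀) (by simp [hw₀])
      have h2 : p.1 v = p.1 (v - b v • w₀) + b v • p.1 w₀ := by simp
      rw [h2]
      exact add_mem h1 (smul_mem _ _ ((hker _).1 h0))
    rw [hrange] at this
    exact this
  let τ : ((V →ₗ[K] U) × K) →ₗ[K] V :=
    t.comp ((LinearMap.applyₗ w₀).comp (LinearMap.fst K (V →ₗ[K] U) K))
  have hτ : ∀ p, τ p = t (p.1 w₀) := fun p => rfl
  have hHdim : finrank K (T.map τ) ≤ finrank K T := Submodule.finrank_map_le _ _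
  have hform : ∀ (y : V) (z : U) (s : K), t z ∉ T.map τ →
      ∃ ψ : LinearMap.ker ξ →ₗ[K] K,
        (∀ p ∈ T, ψ (kerProj ξ x hξ (p.1 w₀)) = p.2 - ξ (p.1 y)) ∧
        ψ (kerProj ξ x hξ z) = s := by
    intro y z s hz
    let Φ : ((V →ₗ[K] U) × K) →ₗ[K] (LinearMap.ker ξ × K) :=
      { toFun := fun p => (kerProj ξ x hξ (p.1 w₀), p.2 - ξ (p.1 y))
        map_add' := fun p q => by
          ext
          · simp
          · simp only [Prod.snd_add, Prod.fst_add, LinearMap.add_apply, map_add]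
            ring
        map_smul' := fun c p => by
          ext
          · simp
          · simp only [Prod.smul_snd, Prod.smul_fst, LinearMap.smul_apply, map_smul, smul_eq_mul,
              RingHom.id_apply]
            ring }
    obtain ⟨ψ, hψ⟩ := exists_functional_of_consistent
      (T.map Φ ⊔ span K {(kerProj ξ x hξ z, s)}) (by
        intro c hc
        obtain ⟨_, ⟨p, hp, rfl⟩, q, hq, hpq⟩ := Submodule.mem_sup.1 hc
        obtain ⟨r, rfl⟩ := mem_span_singleton.1 hq
        have h1 : kerProj ξ x hξ (p.1 w₀) + r • kerProj ξ x hξ z = 0 := congrArg Prod.fst hpq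
        have h2 : p.2 - ξ (p.1 y) + r * s = c := congrArg Prod.snd hpq
        rw [← map_smul, ← map_add, kerProj_eq_zero_iff, ← hker, map_add, map_smul] at h1
        have hr : r = 0 := by
          by_contra hr
          refine hz ⟨-r⁻¹ • p, T.smul_mem _ hp, ?_⟩
          rw [map_smul, hτ, eq_neg_of_add_eq_zero_left h1, smul_neg, neg_smul, neg_neg, smul_smul,
            inv_mul_cancel₀ hr, one_smul]
        rw [hr, zero_smul, add_zero] at h1
        rw [← h2, hzero p hp h1, hr]
        simp)
    exact ⟨ψ, fun p hp => hψ _ (Submodule.mem_sup_left ⟨p, hp, rfl⟩),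
      hψ _ (Submodule.mem_sup_right (mem_span_singleton_self _))⟩
  have hlift : ∀ v, b v = 0 → ∃ u, t u = v := fun v hv => by
    have : v ∈ LinearMap.range t := by rw [hranget]; exact hv
    exact this
  obtain ⟨y₀, hy₀b, hy₀⟩ := exists_mem_notMem_of_finrank_lt (LinearMap.ker b) (T.map τ) (by omega)
  -- For y outside H, ψ may be set to 0 at a preimage of y; it is nonzero as soon as one prescribed
  -- value is. If this never happens, c = ξ(f y) for all y ∈ ker b outside H, and subtracting two
  -- such y shows that ξ ∘ f vanishes on H.
  by_cases hcase : ∃ y, b y = 0 ∧ y ∉ T.map τ ∧ ∃ p ∈ T, p.2 ≠ ξ (p.1 y)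
  · obtain ⟨y, hby, hy, p, hp, hpy⟩ := hcase
    obtain ⟨u, rfl⟩ := hlift y hby
    obtain ⟨ψ, hψ1, hψ2⟩ := hform (t u) u 0 hy
    refine lineSolvable_of_row hUV hb hbt hline hξ htx (fun h => hy (by rw [h]; exact zero_mem _)) hby hw₀ ψ
      ?_ hψ1 u rfl hψ2
    rintro rfl
    exact hpy (sub_eq_zero.1 (hψ1 p hp).symm)
  · push Not at hcase
    have hH : ∀ h ∈ T.map τ, ∀ p ∈ T, ξ (p.1 h) = 0 := by
      intro h hh p hp
      have hbh : b h = 0 := by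
        obtain ⟨q, -, rfl⟩ := hh
        exact hbt _
      have h1 := hcase (y₀ + h) (by rw [map_add, hbh, show b y₀ = 0 from hy₀b, add_zero])
        (fun hmem => hy₀ ((Submodule.add_mem_iff_left _ hh).1 hmem)) p hp
      rw [hcase y₀ hy₀b hy₀ p hp, map_add, map_add] at h1
      exact (add_eq_left.1 h1.symm)
    -- Without such `p`, c is injective on `T`, so dim T = 1 and dim V = 3. Rescaling y₀ in c = ξ(f
    -- y₀) leaves only the scalar 1 as nonzero, so the exceptional hypothesis applies and gives f y₀
    -- = 0, a contradiction.
    obtain ⟨p, hp, hp0, hp2⟩ : ∃ p ∈ T, p ≠ 0 ∧ p.2 = 0 := by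
      by_contra! hno
      have hinj : finrank K T ≤ 1 := by
        have := LinearMap.finrank_le_finrank_of_injective
          (f := (LinearMap.snd K (V →ₗ[K] U) K).domRestrict T) (by
            rw [← LinearMap.ker_eq_bot, LinearMap.ker_eq_bot']
            intro p hp
            by_contra hp0
            exact hno p p.2 (fun h => hp0 (Subtype.ext h)) hp)
        simpa using this
      obtain ⟨p, hp, hp0⟩ := T.ne_bot_iff.1 hT
      have hTpos : 0 < finrank K T :=
        Module.finrank_pos_iff_exists_ne_zero.2 ⟨⟨p, hp⟩, fun h => hp0 (congrArg Subtype.val h)⟩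
      have htp : t (p.1 w₀) ≠ 0 := fun h => hp0 (hzero p hp h)
      have hspan : ∀ h ∈ T.map τ, p.1 h = 0 := by
        intro h hh
        obtain ⟨q, hq, rfl⟩ := id hh
        obtain ⟨c, hc⟩ := mem_span_singleton.1 (hline p hp (τ q) (hbt _))
        have := hH _ hh p hp
        rw [← hc, map_smul, hξ, smul_eq_mul, mul_one] at this
        rw [← hc, this, zero_smul]
      have hy₀p := hcase y₀ hy₀b hy₀ p hp
      have hp2 := hno p hp hp0
      obtain ⟨u₀, hu₀⟩ := hlift y₀ hy₀b
      have hexc' := hexc (by omega) (fun s hs => by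
          have h1 := hcase (s • y₀) (by rw [map_smul, show b y₀ = 0 from hy₀b, smul_zero])
            (fun hmem => hy₀ ((Submodule.smul_mem_iff _ hs).1 hmem)) p hp
          rw [map_smul, map_smul, ← hy₀p, smul_eq_mul] at h1
          exact mul_right_cancel₀ hp2 (by rw [one_mul]; exact h1.symm))
        x hx htx p ⟨hp, hline p hp⟩ ⟨w₀, htp⟩ (fun v => by
          rw [apply_lineConstraint htx hw₀ ⟨hp, hline p hp⟩ v, map_smul,
            hspan (t (p.1 w₀)) ⟨p, hp, rfl⟩, smul_zero]) hp2 u₀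
      rw [hu₀] at hexc'
      rw [hexc', map_zero] at hy₀p
      exact hp2 hy₀p
    have hy : t (p.1 w₀) ≠ 0 := fun h => hp0 (hzero p hp h)
    obtain ⟨u₀, rfl⟩ := hlift y₀ hy₀b
    -- Now y lies in H and its own constraint yields ψ = 0 at the preimage; the value 1 at u₀,
    -- outside the prescribed part, keeps ψ nonzero.
    obtain ⟨ψ, hψ1, hψ2⟩ := hform (t (p.1 w₀)) u₀ 1 hy₀
    refine lineSolvable_of_row hUV hb hbt hline hξ htx hy (hbt _) hw₀ ψ ?_ hψ1 (p.1 w₀) rfl ?_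
    · rintro rfl
      simp at hψ2
    · rw [hψ1 p hp, hp2, hH (t (p.1 w₀)) ⟨p, hp, rfl⟩ p hp, sub_zero]

end Corank

/-! ### Structure of the stuck case with larger kernel -/

section Stuck

universe u v w

variable {K : Type w} {U : Type u} {V : Type v} [Field K] [AddCommGroup U] [Module K U]
  [AddCommGroup V] [Module K V]
  {T : Submodule K ((V →ₗ[K] U) × K)} {t : U →ₗ[K] V} {b : V →ₗ[K] K} {x : U} {y : V}

theorem exists_form_ne_zero_of_notMem_range {v : V} (hv : v ∉ LinearMap.range t) :
    ∃ b : V →ₗ[K] K, b v ≠ 0 ∧ ∀ u, b (t u) = 0 := by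
  obtain ⟨b, hbv, hb⟩ := Submodule.exists_le_ker_of_notMem hv
  exact ⟨b, hbv, fun u => hb ⟨u, rfl⟩⟩

theorem mem_rangeConstraints_of_lineConstraints {w₁ : V} (hw₁ : b w₁ = 1)
    {p : (V →ₗ[K] U) × K} (hp : p ∈ lineConstraints T b x) (h : p.1 w₁ ∈ span K {x}) :
    p ∈ rangeConstraints T x := by
  refine ⟨hp.1, fun v => ?_⟩
  have h1 := hp.2 (v - b v • w₁) (by simp [hw₁])
  have h2 : p.1 v = p.1 (v - b v • w₁) + b v • p.1 w₁ := by simp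
  rw [h2]
  exact add_mem h1 (smul_mem _ _ h)

/-- A corner constraint is a tensor of b with some d ∈ ker t, so its range lies in a line of ker t.
-/
theorem cornerConstraints_eq_bot (hA : ∀ x, x ≠ 0 → t x = 0 → rangeConstraints T x = ⊥)
    (hker : ∃ x, x ≠ 0 ∧ t x = 0) (hb : b ≠ 0) : cornerConstraints T t b = ⊥ := by
  rw [eq_bot_iff]
  intro p hp
  obtain ⟨w₁, hw₁⟩ : ∃ w, b w = 1 := LinearMap.surjective hb 1
  have hval : ∀ v, p.1 v = b v • p.1 w₁ := fun v => by
    have h := hp.2.1 (v - b v • w₁) (by simp [hw₁])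
    rw [map_sub, map_smul, sub_eq_zero] at h
    exact h
  by_cases h0 : p.1 w₁ = 0
  · obtain ⟨x, hx, htx⟩ := hker
    rw [← hA x hx htx]
    exact ⟨hp.1, fun v => by rw [hval, h0, smul_zero]; exact zero_mem _⟩
  · rw [← hA _ h0 (hp.2.2 w₁)]
    exact ⟨hp.1, fun v => by
      rw [hval v]
      exact smul_mem _ _ (mem_span_singleton_self (R := K) (p.1 w₁))⟩

theorem eq_zero_of_mem_span_of_mem_span {x x' u : U} (h : x' ∉ span K {x})
    (h1 : u ∈ span K {x}) (h2 : u ∈ span K {x'}) : u = 0 := by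
  obtain ⟨c, rfl⟩ := mem_span_singleton.1 h2
  by_cases hc : c = 0
  · rw [hc, zero_smul]
  · exact absurd ((Submodule.smul_mem_iff _ hc).1 h1) h

theorem exists_ker_notMem_span [FiniteDimensional K U] (hk : 2 ≤ finrank K (LinearMap.ker t)) (hx : x ≠ 0) :
    ∃ x', t x' = 0 ∧ x' ∉ span K {x} :=
  exists_mem_notMem_of_finrank_lt (LinearMap.ker t) (span K {x} : Submodule K U)
    (by rw [finrank_span_singleton (K := K) hx]; omega)

/-- Such a v is a translation of the admissible set, so f v ∈ Kx for every constraint. Then v meets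
the same hypothesis at an independent x' ∈ ker t, and Kx ∩ Kx' = 0. -/
theorem apply_eq_zero_of_stuck [FiniteDimensional K U]
    (hstuck : ∀ x, x ≠ 0 → t x = 0 → (∃ y, Admissible T t b x y) ∧
      ∀ y, Admissible T t b x y → ∀ p ∈ T, p.1 y ∈ span K {x})
    (hk : 2 ≤ finrank K (LinearMap.ker t)) (hx : x ≠ 0) (htx : t x = 0) {v : V} (hbv : b v = 0)
    (hv : ∀ p ∈ kerLineConstraints T t b x, p.1 v = 0) : ∀ p ∈ T, p.1 v = 0 := by
  have hdir : ∀ x, x ≠ 0 → t x = 0 → (∀ p ∈ kerLineConstraints T t b x, p.1 v = 0) →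
      ∀ p ∈ T, p.1 v ∈ span K {x} := by
    intro x hx htx hv p hp
    obtain ⟨⟨y, hy⟩, h⟩ := hstuck x hx htx
    have hyv : Admissible T t b x (y + v) := ⟨by rw [map_add, hy.1, hbv, add_zero],
      fun p hp => by rw [map_add, hy.2 p hp, hv p hp, add_zero]⟩
    have h1 := h _ hyv p hp
    rw [map_add] at h1
    exact (Submodule.add_mem_iff_right _ (h y hy p hp)).1 h1
  obtain ⟨x', htx', hx'⟩ := exists_ker_notMem_span hk hx
  have hx'0 : x' ≠ 0 := fun h => hx' (h ▸ zero_mem _)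
  have h1 := hdir x hx htx hv
  have h2 := hdir x' hx'0 htx' fun p hp =>
    eq_zero_of_mem_span_of_mem_span hx' (h1 p hp.1.1) (hp.1.2 v hbv)
  exact fun p hp => eq_zero_of_mem_span_of_mem_span hx' (h1 p hp) (h2 p hp)

/-- A nonzero f of `kerLineConstraints` has f w₁ ∉ Kx when b w₁ = 1, while f v = 0 forces b(v) f(w₁)
∈ Kx. -/
theorem form_apply_eq_zero {v : V} (hb : b ≠ 0) (hrange : rangeConstraints T x = ⊥)
    (hne : kerLineConstraints T t b x ≠ ⊥) (hv : ∀ p ∈ T, p.1 v = 0) : b v = 0 := by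
  obtain ⟨p, hp, hp0⟩ := (Submodule.ne_bot_iff _).1 hne
  obtain ⟨w₁, hw₁⟩ : ∃ w, b w = 1 := LinearMap.surjective hb 1
  have hw : p.1 w₁ ∉ span K {x} := fun h => hp0 (by
    have := mem_rangeConstraints_of_lineConstraints hw₁ hp.1 h
    rw [hrange] at this
    exact this)
  have h1 := hp.1.2 (v - b v • w₁) (by simp [hw₁])
  rw [map_sub, hv p hp.1.1, zero_sub, map_smul, neg_mem_iff] at h1
  by_contra h0
  exact hw ((Submodule.smul_mem_iff _ h0).1 h1)

/-- A linear form on operators that vanishes on the tensors of `b` with the kernel of `t` vanishes,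
for some nonzero `x` in this kernel, on all tensors of `x` with forms that vanish on the range. -/
theorem exists_ker_vector_of_form [FiniteDimensional K U] [FiniteDimensional K V]
    (hUV : finrank K U = finrank K V) (hb : b ≠ 0) (hbt : ∀ u, b (t u) = 0)
    (G : (V →ₗ[K] U) →ₗ[K] K) (hG : ∀ d, t d = 0 → G (b.smulRight d) = 0) :
    ∃ x, x ≠ 0 ∧ t x = 0 ∧ ∀ β : V →ₗ[K] K, (∀ u, β (t u) = 0) → G (β.smulRight x) = 0 := by
  let π := (LinearMap.range t).mkQ
  have hfactor : ∀ β : V →ₗ[K] K, (∀ u, β (t u) = 0) →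
      ∃ φ : (V ⧸ LinearMap.range t) →ₗ[K] K, φ ∘ₗ π = β := fun β hβ =>
    ⟨(LinearMap.range t).liftQ β (by
      rintro _ ⟨u, rfl⟩
      exact hβ u), Submodule.liftQ_mkQ _ _ _⟩
  obtain ⟨b', hb'⟩ := hfactor b hbt
  have hb'0 : b' ≠ 0 := by
    rintro rfl
    exact hb hb'.symm
  have hdim := finrank_ker_add_one b' hb'0
  have h1 := Submodule.finrank_quotient_add_finrank (LinearMap.range t)
  have h2 := LinearMap.finrank_range_add_finrank_ker t
  let G' : LinearMap.ker t →ₗ[K] Dual K (Dual K (V ⧸ LinearMap.range t)) :=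
    { toFun := fun d => G ∘ₗ ((LinearMap.smulRightₗ (R := K) (M := U) (M₂ := V)).flip (d : U)) ∘ₗ
        π.dualMap
      map_add' := fun d d' => by
        ext φ
        simp
      map_smul' := fun c d => by
        ext φ
        simp }
  have hG' : ∀ d φ, G' d φ = G ((φ ∘ₗ π).smulRight (d : U)) := fun d φ => rfl
  let g := (Module.evalEquiv K (V ⧸ LinearMap.range t)).symm.toLinearMap ∘ₗ G'
  have hg : ∀ (d : LinearMap.ker t) φ, φ (g d) = G ((φ ∘ₗ π).smulRight (d : U)) := fun d φ =>
    (Module.apply_evalEquiv_symm_apply K _ φ (G' d)).trans (hG' d φ)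
  have hlt : finrank K (LinearMap.ker b') < finrank K (LinearMap.ker t) := by omega
  obtain ⟨x, hxg, hx⟩ := (Submodule.ne_bot_iff _).1 (LinearMap.ker_ne_bot_of_finrank_lt
    (f := LinearMap.codRestrict (LinearMap.ker b') g fun d => by
      rw [LinearMap.mem_ker, hg, hb']
      exact hG d d.2) hlt)
  refine ⟨x, fun h => hx (Subtype.ext h), x.2, fun β hβ => ?_⟩
  obtain ⟨φ, hφ⟩ := hfactor β hβ
  have hgx : g x = 0 := congrArg Subtype.val (LinearMap.mem_ker.1 hxg)
  rw [← hφ, ← hg x φ, hgx, map_zero]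

section Structure

variable [FiniteDimensional K U] [FiniteDimensional K V]
  (hA : ∀ x, x ≠ 0 → t x = 0 → rangeConstraints T x = ⊥)
  (hstuck : ∀ b : V →ₗ[K] K, b ≠ 0 → (∀ u, b (t u) = 0) → ∀ x, x ≠ 0 → t x = 0 →
    (∃ y, Admissible T t b x y) ∧ ∀ y, Admissible T t b x y → ∀ p ∈ T, p.1 y ∈ span K {x})
  (hk : 2 ≤ finrank K (LinearMap.ker t)) (hT : T ≠ ⊥) (hUV : finrank K U = finrank K V)

include hA hstuck hk hT hUV

/-- Otherwise all constraints vanish on ker b, which contains some v₀ outside the range of t. A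
second form b' with b'(v₀) ≠ 0 either has the same defect, and then all constraints vanish on V, or
contradicts `form_apply_eq_zero` at v₀. -/
theorem kerLineConstraints_ne_bot (hb : b ≠ 0) (hbt : ∀ u, b (t u) = 0) (hx : x ≠ 0)
    (htx : t x = 0) : kerLineConstraints T t b x ≠ ⊥ := by
  intro hbot
  have hzero : ∀ v, b v = 0 → ∀ p ∈ T, p.1 v = 0 := fun v hv =>
    apply_eq_zero_of_stuck (hstuck b hb hbt) hk hx htx hv fun p hp => by
      rw [hbot] at hp
      rw [show p = 0 from hp]
      rfl
  have h1 := finrank_ker_add_one b hb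
  have h2 := LinearMap.finrank_range_add_finrank_ker t
  obtain ⟨v₀, hv₀, hv₀t⟩ :=
    exists_mem_notMem_of_finrank_lt (LinearMap.ker b) (LinearMap.range t) (by omega)
  obtain ⟨b', hb'v, hb't⟩ := exists_form_ne_zero_of_notMem_range hv₀t
  have hb' : b' ≠ 0 := by
    rintro rfl
    exact hb'v rfl
  by_cases hbot' : kerLineConstraints T t b' x = ⊥
  · apply hT
    rw [eq_bot_iff, ← hA x hx htx]
    refine fun p hp => ⟨hp, fun v => ?_⟩
    have h3 := apply_eq_zero_of_stuck (v := v - (b' v / b' v₀) • v₀) (hstuck b' hb' hb't) hk hx htx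
      (by rw [map_sub, map_smul, smul_eq_mul, div_mul_cancel₀ _ hb'v, sub_self])
      (fun p hp => by
        rw [hbot'] at hp
        rw [show p = 0 from hp]
        rfl) p hp
    rw [map_sub, map_smul, hzero v₀ hv₀ p hp, smul_zero, sub_zero] at h3
    rw [h3]
    exact zero_mem _
  · exact hb'v (form_apply_eq_zero hb' (hA x hx htx) hbot' (hzero v₀ hv₀))

/-- The structure of the constraints when no compression with one vector reduces them. -/
theorem stuck_structure (hb : b ≠ 0) (hbt : ∀ u, b (t u) = 0) (hx : x ≠ 0) (htx : t x = 0) :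
    (∀ p ∈ T, ∀ u, p.1 (t u) = 0) ∧
    finrank K (kerLineConstraints T t b x) + 1 = finrank K (LinearMap.ker t) ∧
    ∀ w₁, b w₁ = 1 → ∀ d, t d = 0 → ∃ p ∈ kerLineConstraints T t b x, p.1 w₁ - d ∈ span K {x} := by
  obtain ⟨ξ, hξ⟩ := Module.Projective.exists_dual_eq_one K hx
  obtain ⟨w, hw⟩ : ∃ w, b w = 1 := LinearMap.surjective hb 1
  have hrank := LinearMap.finrank_range_add_finrank_ker t
  let g : ((V →ₗ[K] U) × K) →ₗ[K] (V →ₗ[K] K) :=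
    (LinearMap.compRight K ξ).comp (LinearMap.fst K (V →ₗ[K] U) K)
  have hg : ∀ p v, g p v = ξ (p.1 v) := fun p v => rfl
  -- Two bounds meet. The vectors of q ∩ ker b are killed by all of `T`, hence lie in the range of
  -- t, so `kerLineConstraints` has dimension at least dim ker t - 1. Evaluation at w₁, injective
  -- modulo Kx with values in ker t, gives the opposite inequality. Equality yields all three
  -- claims.
  obtain ⟨q, hq, hqdim⟩ := finrank_le_add_finrank_common_ker g (kerLineConstraints T t b x)
  have hqb := finrank_map_add_finrank_eq b q
  have hqb1 : finrank K (q.map b) ≤ 1 := by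
    have := Submodule.finrank_le (q.map b)
    rwa [finrank_self] at this
  have hQ : ∀ v ∈ (q ⊓ LinearMap.ker b : Submodule K V), ∀ p ∈ T, p.1 v = 0 := by
    rintro v ⟨hvq, hvb⟩
    refine apply_eq_zero_of_stuck (hstuck b hb hbt) hk hx htx hvb fun p hp => ?_
    have h1 := (hq v).1 hvq p hp
    obtain ⟨c, hc⟩ := mem_span_singleton.1 (hp.1.2 v hvb)
    rw [hg, ← hc, map_smul, hξ, smul_eq_mul, mul_one] at h1
    rw [← hc, h1, zero_smul]
  have hQt : (q ⊓ LinearMap.ker b : Submodule K V) ≤ LinearMap.range t := by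
    intro v hv
    by_contra hvt
    obtain ⟨b', hb'v, hb't⟩ := exists_form_ne_zero_of_notMem_range hvt
    have hb' : b' ≠ 0 := by
      rintro rfl
      exact hb'v rfl
    exact hb'v (form_apply_eq_zero hb' (hA x hx htx)
      (kerLineConstraints_ne_bot hA hstuck hk hT hUV hb' hb't hx htx) (hQ v hv))
  have hQtdim := Submodule.finrank_mono hQt
  have hsup : ∀ w₁, b w₁ = 1 → ∃ M : Submodule K U,
      M = (kerLineConstraints T t b x).map
        ((LinearMap.applyₗ w₁).comp (LinearMap.fst K (V →ₗ[K] U) K)) ⊔ span K {x} ∧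
      M ≤ LinearMap.ker t ∧ finrank K M = finrank K (kerLineConstraints T t b x) + 1 := by
    intro w₁ hw₁
    have hmem : ∀ p ∈ kerLineConstraints T t b x, p.1 w₁ ∈ span K {x} → p = 0 := by
      intro p hp h
      have h1 := mem_rangeConstraints_of_lineConstraints hw₁ hp.1 h
      rw [hA x hx htx] at h1
      exact h1
    refine ⟨_, rfl, ?_, ?_⟩
    · rw [sup_le_iff]
      constructor
      · rintro _ ⟨p, hp, rfl⟩
        exact hp.2 w₁
      · rw [span_singleton_le_iff_mem]
        exact htx
    · have h1 := finrank_map_add_finrank_eq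
        ((LinearMap.applyₗ w₁).comp (LinearMap.fst K (V →ₗ[K] U) K)) (kerLineConstraints T t b x)
      have h2 : kerLineConstraints T t b x ⊓ LinearMap.ker
          ((LinearMap.applyₗ w₁).comp (LinearMap.fst K (V →ₗ[K] U) K)) = ⊥ := by
        rw [eq_bot_iff]
        rintro p ⟨hp, hp0⟩
        exact hmem p hp (by rw [show p.1 w₁ = 0 from hp0]; exact zero_mem _)
      rw [h2, finrank_bot, add_zero] at h1
      have h3 := Submodule.finrank_sup_add_finrank_inf_eq ((kerLineConstraints T t b x).map
        ((LinearMap.applyₗ w₁).comp (LinearMap.fst K (V →ₗ[K] U) K))) (span K {x})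
      have h4 : (kerLineConstraints T t b x).map
          ((LinearMap.applyₗ w₁).comp (LinearMap.fst K (V →ₗ[K] U) K)) ⊓ span K {x} = ⊥ := by
        rw [eq_bot_iff]
        rintro _ ⟨⟨p, hp, rfl⟩, h⟩
        rw [hmem p hp h, map_zero]
        exact zero_mem _
      rw [h4, finrank_bot, add_zero, finrank_span_singleton hx, h1] at h3
      exact h3
  obtain ⟨M, -, hMt, hMdim⟩ := hsup w hw
  have hMle := Submodule.finrank_mono hMt
  refine ⟨fun p hp u => ?_, by omega, fun w₁ hw₁ d hd => ?_⟩
  · have : (q ⊓ LinearMap.ker b : Submodule K V) = LinearMap.range t :=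
      Submodule.eq_of_le_of_finrank_le hQt (by omega)
    exact hQ _ (this.symm ▸ ⟨u, rfl⟩) p hp
  · obtain ⟨M', hM', hM't, hM'dim⟩ := hsup w₁ hw₁
    have heq : M' = LinearMap.ker t := Submodule.eq_of_le_of_finrank_le hM't (by omega)
    have hdM : d ∈ M' := by
      rw [heq]
      exact hd
    rw [hM'] at hdM
    obtain ⟨_, ⟨p, hp, rfl⟩, z, hz, hpz⟩ := Submodule.mem_sup.1 hdM
    refine ⟨p, hp, ?_⟩
    have : p.1 w₁ - d = -z := by
      rw [← hpz]
      change p.1 w₁ - (p.1 w₁ + z) = -z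
      abel
    rw [this]
    exact neg_mem hz

/-- Some vector of the kernel sees only homogeneous constraints. -/
theorem exists_homogeneous_vector (hb : b ≠ 0) (hbt : ∀ u, b (t u) = 0) :
    ∃ x, x ≠ 0 ∧ t x = 0 ∧ ∀ p ∈ kerLineConstraints T t b x, p.2 = 0 := by
  obtain ⟨x₀, hx₀⟩ : ∃ x : LinearMap.ker t, x ≠ 0 :=
    Module.finrank_pos_iff_exists_ne_zero.1 (by omega : 0 < finrank K (LinearMap.ker t))
  have hcorner : cornerConstraints T t b = ⊥ := cornerConstraints_eq_bot hA
    ⟨x₀, fun h => hx₀ (Subtype.ext h), x₀.2⟩ hb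
  -- `C` asks that b ∘ a vanish on ker t. Since `T` has no corner constraints, this is consistent
  -- with `T`, and the form G realises both. For the x given by G, each f of `kerLineConstraints` is
  -- a sum of a tensor of b with a kernel vector and a tensor α ⊗ x with α ∘ t = 0; G kills both.
  let C : Submodule K ((V →ₗ[K] U) × K) :=
    { carrier := {p | ((∀ w, b w = 0 → p.1 w = 0) ∧ ∀ v, t (p.1 v) = 0) ∧ p.2 = 0}
      add_mem' := fun hp hq => ⟨⟨fun w hw => by
        rw [Prod.fst_add, LinearMap.add_apply, hp.1.1 w hw, hq.1.1 w hw, add_zero], fun v => by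
        rw [Prod.fst_add, LinearMap.add_apply, map_add, hp.1.2, hq.1.2, add_zero]⟩, by
        rw [Prod.snd_add, hp.2, hq.2, add_zero]⟩
      zero_mem' := ⟨⟨fun _ _ => rfl, fun _ => map_zero t⟩, rfl⟩
      smul_mem' := fun c p hp => ⟨⟨fun w hw => by
        rw [Prod.smul_fst, LinearMap.smul_apply, hp.1.1 w hw, smul_zero], fun v => by
        rw [Prod.smul_fst, LinearMap.smul_apply, map_smul, hp.1.2, smul_zero]⟩, by
        rw [Prod.smul_snd, hp.2, smul_zero]⟩ }
  obtain ⟨G, hG⟩ := exists_functional_of_consistent (T ⊔ C) (by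
    intro c hc
    obtain ⟨p, hp, f, hf, hpf⟩ := Submodule.mem_sup.1 hc
    have h1 : p.1 = -f.1 := eq_neg_of_add_eq_zero_left (congrArg Prod.fst hpf)
    have h2 : p.2 + f.2 = c := congrArg Prod.snd hpf
    have h3 : p ∈ cornerConstraints T t b := ⟨hp, fun w hw => by
      rw [h1, LinearMap.neg_apply, hf.1.1 w hw, neg_zero], fun v => by
      rw [h1, LinearMap.neg_apply, map_neg, hf.1.2, neg_zero]⟩
    rw [hcorner] at h3
    rw [← h2, show p = 0 from h3, hf.2, Prod.snd_zero, add_zero])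
  obtain ⟨x, hx, htx, hGx⟩ := exists_ker_vector_of_form hUV hb hbt G fun d hd => by
    have hmem : ((b.smulRight d : V →ₗ[K] U), (0 : K)) ∈ T ⊔ C :=
      Submodule.mem_sup_right ⟨⟨fun w hw => by simp [hw], fun v => by simp [hd]⟩, rfl⟩
    exact hG _ hmem
  refine ⟨x, hx, htx, fun p hp => ?_⟩
  obtain ⟨ξ, hξ⟩ := Module.Projective.exists_dual_eq_one K hx
  obtain ⟨w, hw⟩ : ∃ w, b w = 1 := LinearMap.surjective hb 1
  have hcomp := (stuck_structure hA hstuck hk hT hUV hb hbt hx htx).1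
  let α : V →ₗ[K] K := ξ ∘ₗ (p.1 - b.smulRight (p.1 w))
  have hdec : p.1 = b.smulRight (p.1 w) + α.smulRight x := by
    ext v
    have h1 := hp.1.2 (v - b v • w) (by simp [hw])
    obtain ⟨c, hc⟩ := mem_span_singleton.1 h1
    rw [map_sub, map_smul] at hc
    have h2 : α v = c := by
      change ξ (p.1 v - b v • p.1 w) = c
      rw [← hc, map_smul, hξ, smul_eq_mul, mul_one]
    simp only [LinearMap.add_apply, LinearMap.smulRight_apply]
    rw [h2, hc]
    abel
  have h1 : G (b.smulRight (p.1 w)) = 0 := by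
    have hmem : ((b.smulRight (p.1 w) : V →ₗ[K] U), (0 : K)) ∈ T ⊔ C :=
      Submodule.mem_sup_right ⟨⟨fun w hw => by simp [hw], fun v => by simp [hp.2]⟩, rfl⟩
    exact hG _ hmem
  have h2 : G (α.smulRight x) = 0 := hGx α fun u => by simp [α, hcomp p hp.1.1, hbt]
  rw [← hG p (Submodule.mem_sup_left hp.1.1), hdec, map_add, h1, h2, add_zero]

end Structure

end Stuck

/-! ### Two compressions in the stuck case -/

section TwoSteps

universe u v w

variable {K : Type w} {U : Type u} {V : Type v} [Field K] [AddCommGroup U] [Module K U]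
  [AddCommGroup V] [Module K V] [FiniteDimensional K U] [FiniteDimensional K V]
  {T : Submodule K ((V →ₗ[K] U) × K)} {t : U →ₗ[K] V} {b : V →ₗ[K] K} {x : U} {y : V}

/-- For y in the range of t, f y = 0 by `hcomp`, so the affine conditions read 0 = 0. Only the
values of t ∘ f have to be avoided. -/
theorem exists_adapted_of_homogeneous (htx : t x = 0) (hb : b ≠ 0) (hbt : ∀ u, b (t u) = 0)
    (hcomp : ∀ p ∈ T, ∀ u, p.1 (t u) = 0) (hx2 : ∀ p ∈ kerLineConstraints T t b x, p.2 = 0)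
    (hdim : finrank K T < finrank K (LinearMap.range t) +
      finrank K (kerLineConstraints T t b x)) :
    ∃ y ∈ LinearMap.range t, Adapted T t b x y := by
  obtain ⟨w₁, hw₁⟩ : ∃ w, b w = 1 := LinearMap.surjective hb 1
  let τ : ((V →ₗ[K] U) × K) →ₗ[K] V :=
    t.comp ((LinearMap.applyₗ w₁).comp (LinearMap.fst K (V →ₗ[K] U) K))
  have hτ : ∀ p, τ p = t (p.1 w₁) := fun p => rfl
  have h1 := finrank_map_add_finrank_le τ (lineConstraints T b x) (kerLineConstraints T t b x)
    (fun p hp => hp.1) (fun p hp => hp.2 w₁)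
  have h2 : finrank K (lineConstraints T b x) ≤ finrank K T :=
    Submodule.finrank_mono fun p hp => hp.1
  obtain ⟨y, hyt, hy⟩ := exists_mem_notMem_of_finrank_lt (LinearMap.range t)
    ((lineConstraints T b x).map τ) (by omega)
  refine ⟨y, hyt, fun h => hy (h ▸ zero_mem _), ?_, fun p hp hpy => ?_⟩
  · obtain ⟨u, rfl⟩ := hyt
    exact hbt u
  · obtain ⟨s, hs⟩ := mem_span_singleton.1 (hpy w₁)
    have hs0 : s = 0 := by
      by_contra hs0
      refine hy ⟨s⁻¹ • p, smul_mem _ _ hp, ?_⟩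
      rw [map_smul, hτ, ← hs, smul_smul, inv_mul_cancel₀ hs0, one_smul]
    have hp2 : p ∈ kerLineConstraints T t b x := ⟨hp, fun v => by
      rw [apply_lineConstraint htx hw₁ hp, ← hs, hs0, zero_smul, smul_zero]⟩
    obtain ⟨u, rfl⟩ := hyt
    rw [hcomp p hp.1, hx2 p hp2, zero_smul]

/-- The first compression may lose no constraint. Afterwards, each form that vanishes on the range
of t gives a constraint with range in the line of the image x' of d. Two independent such forms
exist since t has corank at least two, so compressing along x' removes two dimensions at once. -/
theorem lineSolvable_of_stuck {m : ℕ} (ih : SolvableInDim.{u, v, w} K m)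
    (hU : finrank K U = m + 2) (hV : finrank K V = m + 2)
    (hA : ∀ x, x ≠ 0 → t x = 0 → rangeConstraints T x = ⊥)
    (hstuck : ∀ b : V →ₗ[K] K, b ≠ 0 → (∀ u, b (t u) = 0) → ∀ x, x ≠ 0 → t x = 0 →
      (∃ y, Admissible T t b x y) ∧ ∀ y, Admissible T t b x y → ∀ p ∈ T, p.1 y ∈ span K {x})
    (hk : 2 ≤ finrank K (LinearMap.ker t)) (hT : T ≠ ⊥) (hdim : finrank K T = m)
    (hb : b ≠ 0) (hbt : ∀ u, b (t u) = 0) : LineSolvable T t := by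
  have hUV : finrank K U = finrank K V := hU.trans hV.symm
  obtain ⟨x, hx, htx, hx2⟩ := exists_homogeneous_vector hA hstuck hk hT hUV hb hbt
  obtain ⟨hcomp, hkdim, hsurj⟩ := stuck_structure hA hstuck hk hT hUV hb hbt hx htx
  have hrank := LinearMap.finrank_range_add_finrank_ker t
  obtain ⟨y, hyt, hy⟩ := exists_adapted_of_homogeneous htx hb hbt hcomp hx2 (by omega)
  have hTy : ∀ p ∈ T, p.1 y = 0 := by
    obtain ⟨u, rfl⟩ := hyt
    exact fun p hp => hcomp p hp u
  obtain ⟨ξ, hξ⟩ := Module.Projective.exists_dual_eq_one K hx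
  obtain ⟨η, hη⟩ := Module.Projective.exists_dual_eq_one K hy.1
  have hξ' := finrank_ker_add_one ξ (ne_zero_of_apply_eq_one hξ)
  have hη' := finrank_ker_add_one η (ne_zero_of_apply_eq_one hη)
  refine lineSolvable_of_compress hξ hη htx ?_
  have hcompat := hy.compatible_compress hξ hη htx
  have hcomp' := compressAll_comp_eq_zero hcomp hξ hη
  have hdim' := hy.finrank_compressAll_add_le hξ htx (η := η)
  have hb' := comp_subtype_ker_ne_zero hb hη hy.2.1
  have hbt' := comp_subtype_compress (t := t) (ξ := ξ) hbt hη hy.2.1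
  obtain ⟨d, htd, hd⟩ := exists_ker_notMem_span hk hx
  -- constraints of the compressed problem with range in the line of the image of `d`
  have himage : ∀ β : V →ₗ[K] K, β ≠ 0 → (∀ u, β (t u) = 0) →
      ∃ q ∈ compressAll T ξ x hξ η y, (∀ v, t (q.1 v : U) = 0) ∧
        ∀ v : LinearMap.ker η, q.1 v = β v • kerProj ξ x hξ d := by
    intro β hβ hβt
    obtain ⟨w₁, hw₁⟩ : ∃ w, β w = 1 := LinearMap.surjective hβ 1
    obtain ⟨p, hp, hpd⟩ :=
      (stuck_structure hA hstuck hk hT hUV hβ hβt hx htx).2.2 w₁ hw₁ d htd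
    refine ⟨compressConstraint ξ x hξ η y p, mem_compressAll.2 ⟨p, hp.1.1, by
      rw [hTy p hp.1.1]
      exact zero_mem _, rfl, rfl⟩, fun v => ?_, fun v => ?_⟩
    · change t (kerProj ξ x hξ (p.1 v) : U) = 0
      rw [map_kerProj hξ htx]
      exact hp.2 v
    · change kerProj ξ x hξ (p.1 v) = _
      rw [← map_smul, ← sub_eq_zero, ← map_sub, kerProj_eq_zero_iff]
      have h1 := hp.1.2 ((v : V) - β v • w₁) (by simp [hw₁])
      rw [map_sub, map_smul] at h1
      have h2 := add_mem h1 (smul_mem (span K {x}) (β v) hpd)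
      rw [smul_sub, sub_add_sub_cancel] at h2
      exact h2
  generalize compressAll T ξ x hξ η y = T' at *
  have hd0 : kerProj ξ x hξ d ≠ 0 := fun h => hd ((kerProj_eq_zero_iff ξ x hξ d).1 h)
  have htd' : compress ξ η y hη t (kerProj ξ x hξ d) = 0 := by
    rw [compress_apply, map_kerProj hξ htx, htd, map_zero]
  generalize kerProj ξ x hξ d = x' at *
  obtain ⟨w₁, hw₁⟩ : ∃ w, b w = 1 := LinearMap.surjective hb 1
  have heval : ∀ (β : V →ₗ[K] K) (v : V), (∀ u, β (t u) = 0) →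
      β (kerProj η y hη v : V) = β v := by
    intro β v hβ
    obtain ⟨u, rfl⟩ := hyt
    rw [kerProj_coe, map_sub, map_smul, hβ, smul_zero, sub_zero]
  obtain ⟨q, hq, hqt, hqval⟩ := himage b hb hbt
  have hcorner : 0 < finrank K (cornerConstraints T' (compress ξ η y hη t)
      (b ∘ₗ (LinearMap.ker η).subtype)) := by
    refine finrank_pos_of_mem_ne_zero (e := q) ⟨hq, fun w hw => ?_, fun v => ?_⟩ fun h => ?_
    · rw [hqval, show b (w : V) = 0 from hw, zero_smul]
    · rw [compress_apply, hqt, map_zero]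
    · have h1 : q.1 (kerProj η y hη w₁) = 0 := by
        rw [h]
        rfl
      rw [hqval, heval b w₁ hbt, hw₁, one_smul] at h1
      exact hd0 h1
  obtain ⟨⟨y', hy'⟩, -⟩ := exists_adapted hb' hbt' hd0 htd' hcompat (by omega)
  have hrange : 2 ≤ finrank K (rangeConstraints T' x') := by
    have hbW := finrank_ker_add_one b hb
    obtain ⟨v₀, hv₀, hv₀t⟩ :=
      exists_mem_notMem_of_finrank_lt (LinearMap.ker b) (LinearMap.range t) (by omega)
    obtain ⟨β, hβv, hβt⟩ := exists_form_ne_zero_of_notMem_range hv₀t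
    have hβ : β ≠ 0 := by
      rintro rfl
      exact hβv rfl
    obtain ⟨r, hr, -, hrval⟩ := himage β hβ hβt
    have hmem : ∀ (q : (LinearMap.ker η →ₗ[K] LinearMap.ker ξ) × K) (γ : V →ₗ[K] K), q ∈ T' →
        (∀ v : LinearMap.ker η, q.1 v = γ v • x') → q ∈ rangeConstraints T' x' :=
      fun q γ hq h => ⟨hq, fun v => by
        rw [h]
        exact smul_mem _ _ (mem_span_singleton_self x')⟩
    refine two_le_finrank_of_pair (hmem q b hq hqval) (hmem r β hr hrval) fun c e hce => ?_
    have hce' : ∀ v : V, (c * b v + e * β v) • x' = 0 := by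
      intro v
      have h1 : c • q.1 (kerProj η y hη v) + e • r.1 (kerProj η y hη v) = 0 :=
        LinearMap.congr_fun (congrArg Prod.fst hce) _
      rw [hqval, hrval, heval b v hbt, heval β v hβt, smul_smul, smul_smul, ← add_smul] at h1
      exact h1
    have he : e = 0 := by
      have h1 := (smul_eq_zero.1 (hce' v₀)).resolve_right hd0
      rw [show b v₀ = 0 from hv₀, mul_zero, zero_add] at h1
      exact (mul_eq_zero.1 h1).resolve_right hβv
    have hc : c = 0 := by
      have h1 := (smul_eq_zero.1 (hce' w₁)).resolve_right hd0
      rwa [hw₁, he, zero_mul, add_zero, mul_one] at h1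
    exact ⟨hc, he⟩
  obtain ⟨ξ', hξ'1⟩ := Module.Projective.exists_dual_eq_one K hd0
  obtain ⟨η', hη'1⟩ := Module.Projective.exists_dual_eq_one K hy'.1
  have hξ'' := finrank_ker_add_one ξ' (ne_zero_of_apply_eq_one hξ'1)
  have hη'' := finrank_ker_add_one η' (ne_zero_of_apply_eq_one hη'1)
  have hdim'' := hy'.finrank_compressAll_add_le hξ'1 htd' (η := η')
  exact lineSolvable_of_compress hξ'1 hη'1 htd' (ih (LinearMap.ker ξ') (LinearMap.ker η')
    (by omega) (by omega) _ _ _ (comp_subtype_ker_ne_zero hb' hη'1 hy'.2.1)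
    (comp_subtype_compress hbt' hη'1 hy'.2.1) (hy'.compatible_compress hξ'1 hη'1 htd')
    (by omega) fun _ _ => unexceptional_of_comp_eq_zero
      (compressAll_comp_eq_zero hcomp' hξ'1 hη'1))

end TwoSteps

/-! ### Small subspaces, and counting over the field with two elements -/

section Pairs

variable {K E F : Type*} [Field K] [AddCommGroup E] [Module K E] [AddCommGroup F] [Module K F]

theorem pair_independent_of_mem_notMem {Q : Submodule K E} {e f : E} (he : e ∈ Q) (he0 : e ≠ 0)
    (hf : f ∉ Q) (c d : K) (h : c • e + d • f = 0) : c = 0 ∧ d = 0 := by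
  have hd : d = 0 := by
    by_contra hd
    refine hf ((Submodule.smul_mem_iff _ hd).1 ?_)
    rw [eq_neg_of_add_eq_zero_right h]
    exact neg_mem (smul_mem _ _ he)
  rw [hd, zero_smul, add_zero] at h
  exact ⟨(smul_eq_zero.1 h).resolve_right he0, hd⟩

variable [FiniteDimensional K E]

theorem exists_eq_combination_of_finrank_le_two {P : Submodule K E} (hP : finrank K P ≤ 2)
    {e f : E} (he : e ∈ P) (hf : f ∈ P) (h : ∀ c d : K, c • e + d • f = 0 → c = 0 ∧ d = 0)
    {g : E} (hg : g ∈ P) : ∃ c d : K, g = c • e + d • f := by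
  have hle : span K {e, f} ≤ P := by
    rw [span_le]
    rintro z (rfl | rfl)
    · exact he
    · exact hf
  have h2 : 2 ≤ finrank K (span K {e, f}) :=
    two_le_finrank_of_pair (subset_span (by simp)) (subset_span (by simp)) h
  have heq := Submodule.eq_of_le_of_finrank_le hle (hP.trans h2)
  rw [← heq, mem_span_pair] at hg
  obtain ⟨c, d, h⟩ := hg
  exact ⟨c, d, h.symm⟩

theorem not_four_of_finrank_le_two {P : Submodule K E} (hP : finrank K P ≤ 2)
    (hK : ∀ s : K, s ≠ 0 → s = 1) {e f g h : E} (he : e ∈ P) (hf : f ∈ P) (hg : g ∈ P)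
    (hh : h ∈ P) (he0 : e ≠ 0) (hf0 : f ≠ 0) (hg0 : g ≠ 0) (hh0 : h ≠ 0) (hef : f ≠ e)
    (hge : g ≠ e) (hhe : h ≠ e) (hfg : f ≠ g) (hfh : f ≠ h) (hgh : g ≠ h) : False := by
  have hspan : f ∉ span K {e} := by
    rw [mem_span_singleton]
    rintro ⟨c, rfl⟩
    by_cases hc : c = 0
    · exact hf0 (by rw [hc, zero_smul])
    · exact hef (by rw [hK c hc, one_smul])
  have hsum : ∀ g ∈ P, g ≠ 0 → g ≠ e → f ≠ g → g = e + f := by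
    intro g hg hg0 hge hfg
    obtain ⟨c, d, hcd⟩ := exists_eq_combination_of_finrank_le_two hP he hf
      (pair_independent_of_mem_notMem (mem_span_singleton_self e) he0 hspan) hg
    by_cases hc : c = 0
    · by_cases hd : d = 0
      · rw [hc, hd] at hcd
        exact absurd (by simpa using hcd) hg0
      · rw [hc, hK d hd] at hcd
        exact absurd (by simpa using hcd.symm) hfg
    · by_cases hd : d = 0
      · rw [hK c hc, hd] at hcd
        exact absurd (by simpa using hcd) hge
      · rw [hcd, hK c hc, hK d hd, one_smul, one_smul]
  exact hgh ((hsum g hg hg0 hge hfg).trans (hsum h hh hh0 hhe hfh).symm)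

theorem three_le_finrank {R : Submodule K E} {Q : Submodule K F} (f : E →ₗ[K] F) {y v z : E}
    (hy : y ∈ R) (hv : v ∈ R) (hz : z ∈ R) (hy0 : y ≠ 0) (hvy : v ∉ span K {y})
    (hfy : f y ∈ Q) (hfv : f v ∈ Q) (hfz : f z ∉ Q) : 3 ≤ finrank K R := by
  have h2 : 2 ≤ finrank K (R ⊓ Q.comap f : Submodule K E) :=
    two_le_finrank_of_pair (e := y) (f := v) ⟨hy, hfy⟩ ⟨hv, hfv⟩
      (pair_independent_of_mem_notMem (mem_span_singleton_self y) hy0 hvy)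
  have hlt : (R ⊓ Q.comap f : Submodule K E) < R :=
    lt_of_le_of_ne inf_le_left fun h => hfz (by
      rw [← h] at hz
      exact hz.2)
  have := Submodule.finrank_lt_finrank_of_lt hlt
  omega

end Pairs

/-! ### Avoiding the exception: dimension four over the field with two elements -/

section DimensionFour

variable {K U V : Type*} [Field K] [AddCommGroup U] [Module K U] [AddCommGroup V] [Module K V]
  {T : Submodule K ((V →ₗ[K] U) × K)} {t : U →ₗ[K] V} {b : V →ₗ[K] K} {x : U} {y : V}

theorem apply_mem_span_of_mem_span_pair {x x' u : U} (htx : t x = 0) (htx' : t x' ∈ span K {y})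
    (hu : u ∈ span K {x, x'}) : t u ∈ span K {y} := by
  obtain ⟨c, d, rfl⟩ := mem_span_pair.1 hu
  rw [map_add, map_smul, map_smul, htx, smul_zero, zero_add]
  exact smul_mem _ _ htx'

variable [FiniteDimensional K V]

/-- The range contains the independent vectors y and t(f v), which f sends into Kx, and t u, which
it does not. -/
theorem ExceptionalAt.three_le_finrank_range (h : ExceptionalAt T t b x y) (hy0 : y ≠ 0)
    (hy : y ∈ LinearMap.range t) : 3 ≤ finrank K (LinearMap.range t) := by
  obtain ⟨x', -, -, p, -, hpy, -, ⟨v, hv⟩, hpp, ⟨u, hu⟩⟩ := h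
  exact three_le_finrank p.1 hy ⟨_, rfl⟩ ⟨_, rfl⟩ hy0 hv hpy (hpp v) hu

variable [FiniteDimensional K U]

/-- An unexceptional value, when the kernel of `t` is a line that is the range of a constraint. -/
theorem exists_unexceptional_of_corank_one_of_range (hV : finrank K V = 4) (hb : b ≠ 0)
    (hbt : ∀ u, b (t u) = 0) (hT : Compatible T t b) (hdim : finrank K T ≤ 2) (hx : x ≠ 0)
    (htx : t x = 0) (hker : ∀ u, t u = 0 → u ∈ span K {x}) (hy : Adapted T t b x y)
    (hexc : ExceptionalAt T t b x y) (hrange : rangeConstraints T x ≠ ⊥) :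
    ∃ y, Adapted T t b x y ∧ Reducing T x y ∧ ¬ ExceptionalAt T t b x y := by
  obtain ⟨x', -, htx', f, hf, hfy, hfW, -, -, ⟨u, hu⟩⟩ := hexc
  obtain ⟨g, hg, hg0⟩ := (Submodule.ne_bot_iff _).1 hrange
  have hfl : f ∉ lineConstraints T b x := fun h => hu (h.2 _ (hbt u))
  have hcomb : ∀ p ∈ T, ∃ c d : K, p = c • g + d • f := fun p hp =>
    exists_eq_combination_of_finrank_le_two hdim hg.1 hf
      (pair_independent_of_mem_notMem hg hg0 fun h =>
        hfl (rangeConstraints_le_lineConstraints T b x h)) hp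
  obtain ⟨ξ, hξ⟩ := Module.Projective.exists_dual_eq_one K hx
  obtain ⟨w, ⟨hwb, hwg⟩, hwy⟩ : ∃ w ∈ (LinearMap.ker b ⊓ LinearMap.ker (ξ ∘ₗ g.1) : Submodule K V),
      w ∉ span K {y} := by
    refine exists_mem_notMem_of_finrank_lt _ _ ?_
    have h1 := finrank_ker_add_one b hb
    have h2 := finrank_map_add_finrank_eq (ξ ∘ₗ g.1) (LinearMap.ker b)
    have h3 := Submodule.finrank_le ((LinearMap.ker b).map (ξ ∘ₗ g.1))
    rw [finrank_self] at h3
    rw [finrank_span_singleton hy.1]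
    omega
  have hgw : g.1 w = 0 := by
    obtain ⟨c, hc⟩ := mem_span_singleton.1 (hg.2 w)
    have h1 : ξ (g.1 w) = 0 := hwg
    rw [← hc, map_smul, hξ, smul_eq_mul, mul_one] at h1
    rw [← hc, h1, zero_smul]
  have hadm : Admissible T t b x (y + w) := by
    refine ⟨by rw [map_add, hy.2.1, show b w = 0 from hwb, add_zero], fun p hp => ?_⟩
    rw [map_add, hy.admissible.2 p hp]
    obtain ⟨c, d, rfl⟩ := hcomb p hp.1.1
    have hd : d = 0 := by
      by_contra hd
      refine hfl ((Submodule.smul_mem_iff _ hd).1 ?_)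
      have := (lineConstraints T b x).sub_mem hp.1
        (smul_mem _ c (rangeConstraints_le_lineConstraints T b x hg))
      rwa [add_sub_cancel_left] at this
    rw [hd, zero_smul, add_zero, Prod.smul_fst, LinearMap.smul_apply, hgw, smul_zero, add_zero]
  have hsel := (exists_adapted hb hbt hx htx hT (by omega)).2 (span K {y})
  -- An exceptional y determines the line t(f(ker b)), and modulo g, which t kills, all constraints
  -- are multiples of f. So an adapted vector off Ky cannot be exceptional too.
  obtain ⟨y₂, hy₂, hy₂y⟩ : ∃ y₂, Adapted T t b x y₂ ∧ y₂ ∉ span K {y} := by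
    by_contra! hno
    exact hwy ((Submodule.add_mem_iff_right _ (mem_span_singleton_self y)).1
      (hsel hno _ hadm))
  refine ⟨y₂, hy₂, Or.inr ⟨by omega, Or.inl hrange⟩, ?_⟩
  rintro ⟨x₂, -, htx₂, p, hp, -, hpW, -, -, ⟨u₂, hu₂⟩⟩
  obtain ⟨c, d, rfl⟩ := hcomb p hp
  have h1 := apply_mem_span_of_mem_span_pair htx htx₂ (hpW (t u₂) (hbt u₂))
  refine hu₂ (hker _ (eq_zero_of_mem_span_of_mem_span hy₂y ?_ h1))
  rw [Prod.fst_add, Prod.smul_fst, Prod.smul_fst, LinearMap.add_apply, LinearMap.smul_apply,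
    LinearMap.smul_apply, map_add, map_smul, map_smul,
    map_eq_zero_of_mem_span htx (hg.2 (t u₂)), smul_zero, zero_add]
  exact smul_mem _ _ (apply_mem_span_of_mem_span_pair htx htx' (hfW _ (hbt u₂)))

/-- An unexceptional value, when the kernel of `t` is a line that is not the range of a
constraint. -/
theorem exists_unexceptional_of_corank_one (hV : finrank K V = 4) (hK : ∀ s : K, s ≠ 0 → s = 1)
    (hb : b ≠ 0) (hbt : ∀ u, b (t u) = 0) (hdim : finrank K T ≤ 2)
    (htx : t x = 0) (hker : ∀ u, t u = 0 → u ∈ span K {x}) (hy : Adapted T t b x y)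
    (hexc : ExceptionalAt T t b x y) (hrange : rangeConstraints T x = ⊥) :
    ∃ y, Adapted T t b x y ∧ Reducing T x y ∧ ¬ ExceptionalAt T t b x y := by
  obtain ⟨x', -, -, f, hf, hfy, -, ⟨v, hv⟩, hfv, ⟨u, hu⟩⟩ := hexc
  obtain ⟨w₁, hw₁⟩ : ∃ w, b w = 1 := LinearMap.surjective hb 1
  by_contra! hno
  have hfl : f ∉ lineConstraints T b x := fun h => hu (h.2 _ (hbt u))
  -- `R p z` records that `p` spoils z, either as value at x or as unexceptional one; in both cases
  -- `p` determines the line of z.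
  let R : ((V →ₗ[K] U) × K) → V → Prop := fun p z =>
    (p ∈ lineConstraints T b x ∧ (∀ v, t (p.1 v) ∈ span K {z}) ∧ ∃ v, t (p.1 v) ≠ 0) ∨
      (∀ w, b w = 0 → t (p.1 w) ∈ span K {z}) ∧ ∃ w, b w = 0 ∧ t (p.1 w) ≠ 0
  have hR : ∀ p z z', R p z → R p z' → z' ∈ span K {z} := by
    rintro p z z' (⟨hp, h1, s, hs⟩ | ⟨h1, s, hsb, hs⟩) (⟨hp', h2, r, hr⟩ | ⟨h2, r, hrb, hr⟩)
    · by_contra hz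
      exact hs (eq_zero_of_mem_span_of_mem_span hz (h1 s) (h2 s))
    · exact absurd (map_eq_zero_of_mem_span htx (hp.2 r hrb)) hr
    · exact absurd (map_eq_zero_of_mem_span htx (hp'.2 s hsb)) hs
    · by_contra hz
      exact hs (eq_zero_of_mem_span_of_mem_span hz (h1 s hsb) (h2 s hsb))
  have hbad : ∀ z, b z = 0 → f.1 z ∉ span K {x} → ∃ p ∈ T, R p z ∧ p ≠ 0 ∧ p ≠ f := by
    intro z hbz hfz
    by_cases hz : Adapted T t b x z
    · have hexc := hno z hz (Or.inr ⟨by omega, Or.inr ⟨f, hf, hfz⟩⟩)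
      obtain ⟨x₂, -, htx₂, p, hp, hpz, hpW, -, -, ⟨u₂, hu₂⟩⟩ := hexc
      refine ⟨p, hp, Or.inr ⟨fun w hw => apply_mem_span_of_mem_span_pair htx htx₂ (hpW w hw),
        t u₂, hbt u₂, fun h => hu₂ (hker _ h)⟩, ?_, ?_⟩
      · rintro rfl
        exact hu₂ (zero_mem _)
      · rintro rfl
        exact hfz hpz
    · have hz0 : z ≠ 0 := by
        rintro rfl
        exact hfz (by rw [map_zero]; exact zero_mem _)
      have : ¬ ∀ p ∈ lineConstraints T b x, (∀ v, t (p.1 v) ∈ span K {z}) → p.1 z = p.2 • x :=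
        fun h => hz ⟨hz0, hbz, h⟩
      push Not at this
      obtain ⟨p, hp, hpz, hne⟩ := this
      have hp0 : p ≠ 0 := by
        rintro rfl
        simp at hne
      refine ⟨p, hp.1, Or.inl ⟨hp, hpz, ?_⟩, hp0, ?_⟩
      · by_contra! h
        have := mem_rangeConstraints_of_lineConstraints hw₁ hp (hker _ (h w₁))
        rw [hrange] at this
        exact hp0 this
      · rintro rfl
        exact hfl hp
  have hf0 : f ≠ 0 := by
    rintro rfl
    exact hfl (zero_mem _)
  have hv0 : t (f.1 v) ≠ 0 := fun h => hv (by rw [h]; exact zero_mem _)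
  have hshift : ∀ y, f.1 y ∈ span K {x} → f.1 (t u + y) ∉ span K {x} := fun y hy h =>
    hu (by rw [map_add] at h; exact (Submodule.add_mem_iff_left _ hy).1 h)
  -- two translates of `t u` are proportional only if they are equal
  have hprop : ∀ y y', f.1 y ∈ span K {x} → f.1 y' ∈ span K {x} → y' ≠ y →
      t u + y' ∉ span K {t u + y} := by
    intro y y' hy hy' hne hmem
    obtain ⟨c, hc⟩ := mem_span_singleton.1 hmem
    have hc1 : (c - 1) • t u = y' - c • y := by
      rw [sub_smul, one_smul, sub_eq_sub_iff_add_eq_add, ← smul_add, hc, add_comm]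
    by_cases h1 : c = 1
    · rw [h1, sub_self, zero_smul, one_smul] at hc1
      exact hne (sub_eq_zero.1 hc1.symm)
    · refine hu ((Submodule.smul_mem_iff _ (sub_ne_zero.2 h1)).1 ?_)
      rw [← map_smul, hc1, map_sub, map_smul]
      exact sub_mem hy' (smul_mem _ _ hy)
  have hf00 : f.1 (0 : V) ∈ span K {x} := by
    rw [map_zero]
    exact zero_mem _
  obtain ⟨p₁, hp₁, hR₁, hp₁0, hp₁f⟩ := hbad (t u + 0) (by rw [add_zero, hbt]) (hshift 0 hf00)
  obtain ⟨p₂, hp₂, hR₂, hp₂0, hp₂f⟩ := hbad (t u + y) (by rw [map_add, hbt, hy.2.1, add_zero])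
    (hshift y hfy)
  obtain ⟨p₃, hp₃, hR₃, hp₃0, hp₃f⟩ := hbad (t u + t (f.1 v)) (by rw [map_add, hbt, hbt, add_zero])
    (hshift _ (hfv v))
  -- The pairwise non-proportional vectors t u, t u + y and t u + t(f v) are spoiled by three
  -- distinct constraints, all different from f and 0. A space of dimension at most two over this
  -- field has only three nonzero vectors.
  refine not_four_of_finrank_le_two hdim hK hf hp₁ hp₂ hp₃ hf0 hp₁0 hp₂0 hp₃0 hp₁f hp₂f hp₃f ?_ ?_ ?_
  · rintro rfl
    exact hprop 0 y hf00 hfy hy.1 (hR _ _ _ hR₁ hR₂)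
  · rintro rfl
    exact hprop 0 _ hf00 (hfv v) hv0 (hR _ _ _ hR₁ hR₃)
  · rintro rfl
    exact hprop y _ hfy (hfv v) (fun h => hv (by rw [h]; exact mem_span_singleton_self y))
      (hR _ _ _ hR₂ hR₃)

/-- An unexceptional value, when `t` has rank two and `x` spans the range of a constraint. -/
theorem exists_unexceptional_of_rank_two_of_range (hV : finrank K V = 4)
    (hbt : ∀ u, b (t u) = 0) (hdim : finrank K T ≤ 2)
    (hrank : finrank K (LinearMap.range t) ≤ 2) (hy : Adapted T t b x y) (htx : t x = 0)
    (hexc : ExceptionalAt T t b x y) (hrange : rangeConstraints T x ≠ ⊥) :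
    ∃ y, Adapted T t b x y ∧ Reducing T x y ∧ ¬ ExceptionalAt T t b x y := by
  obtain ⟨x', -, -, f, hf, hfy, -, ⟨v, hv⟩, hfv, ⟨u, hu⟩⟩ := hexc
  obtain ⟨g, hg, hg0⟩ := (Submodule.ne_bot_iff _).1 hrange
  have hfl : f ∉ lineConstraints T b x := fun h => hu (h.2 _ (hbt u))
  have hgl := rangeConstraints_le_lineConstraints T b x hg
  have hcomb : ∀ p ∈ T, ∃ c d : K, p = c • g + d • f := fun p hp =>
    exists_eq_combination_of_finrank_le_two hdim hg.1 hf
      (pair_independent_of_mem_notMem hgl hg0 hfl) hp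
  have hgood : ∀ z, z ≠ 0 → b z = 0 → g.1 z = g.2 • x →
      (z ∈ LinearMap.range t ∨ f.1 z ∉ span K {x}) →
      ∃ y, Adapted T t b x y ∧ Reducing T x y ∧ ¬ ExceptionalAt T t b x y := by
    intro z hz0 hbz hgz hz
    refine ⟨z, ⟨hz0, hbz, fun p hp _ => ?_⟩, Or.inr ⟨by omega, Or.inl hrange⟩, fun hexc => ?_⟩
    · obtain ⟨c, d, rfl⟩ := hcomb p hp.1
      have hd : d = 0 := by
        by_contra hd
        refine hfl ((Submodule.smul_mem_iff _ hd).1 ?_)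
        have := (lineConstraints T b x).sub_mem hp (smul_mem _ c hgl)
        rwa [add_sub_cancel_left] at this
      rw [hd, zero_smul, add_zero, Prod.smul_fst, LinearMap.smul_apply, hgz, Prod.smul_snd,
        smul_smul, smul_eq_mul]
    · rcases hz with hz | hz
      · have := hexc.three_le_finrank_range hz0 hz
        omega
      · obtain ⟨x₂, -, -, p, hp, hpz, -, -, -, ⟨u₂, hu₂⟩⟩ := hexc
        obtain ⟨c, d, rfl⟩ := hcomb p hp
        have hd : d ≠ 0 := by
          rintro rfl
          rw [zero_smul, add_zero] at hu₂
          exact hu₂ (smul_mem _ _ (hg.2 _))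
        exact hz ((Submodule.smul_mem_iff _ hd).1
          ((Submodule.add_mem_iff_right _ (smul_mem _ c (hg.2 z))).1 hpz))
  have hgy : g.1 y = g.2 • x := hy.2.2 g hgl fun w => by
    rw [map_eq_zero_of_mem_span htx (hg.2 w)]
    exact zero_mem _
  have hne : ∀ z, f.1 z ∉ span K {x} → z ≠ 0 := by
    rintro z hz rfl
    exact hz (by rw [map_zero]; exact zero_mem _)
  have hv0 : t (f.1 v) ≠ 0 := fun h => hv (by rw [h]; exact zero_mem _)
  obtain ⟨α, hα⟩ : ∃ α : V → K, ∀ w, α w • x = g.1 w :=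
    ⟨_, fun w => (mem_span_singleton.1 (hg.2 w)).choose_spec⟩
  have hyz : ∀ c : K, f.1 (y + (t u - c • t (f.1 v))) ∉ span K {x} := fun c h => hu (by
    rw [map_add, map_sub, map_smul] at h
    have h1 := (Submodule.add_mem_iff_right _ hfy).1 h
    exact (Submodule.sub_mem_iff_left _ (smul_mem _ c (hfv v))).1 h1)
  have hyz' : ∀ c : K, g.1 (t u - c • t (f.1 v)) = 0 →
      ∃ y, Adapted T t b x y ∧ Reducing T x y ∧ ¬ ExceptionalAt T t b x y := fun c hc =>
    hgood _ (hne _ (hyz c)) (by simp [hy.2.1, hbt]) (by rw [map_add, hgy, hc, add_zero])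
      (Or.inr (hyz c))
  -- By `hgood`, z needs g z = g.2 • x and must lie in the range of t or satisfy f z ∉ Kx. Either c
  -- can be chosen so that g kills t u - c t(f v), or t(f v) or a multiple of t u serves as z.
  by_cases hgv : α (t (f.1 v)) = 0
  · by_cases hgz : α (t u) = 0
    · exact hyz' 0 (by rw [zero_smul, sub_zero, ← hα, hgz, zero_smul])
    · by_cases hg2 : g.2 = 0
      · exact hgood _ hv0 (hbt _) (by rw [← hα, hgv, hg2]) (Or.inl ⟨_, rfl⟩)
      · have hs : f.1 ((g.2 / α (t u)) • t u) ∉ span K {x} := fun h => hu (by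
          rw [map_smul] at h
          exact (Submodule.smul_mem_iff _ (div_ne_zero hg2 hgz)).1 h)
        exact hgood _ (hne _ hs) (by rw [map_smul, hbt, smul_zero])
          (by rw [map_smul, ← hα, smul_smul, div_mul_cancel₀ _ hgz]) (Or.inr hs)
  · exact hyz' (α (t u) / α (t (f.1 v))) (by
      rw [map_sub, map_smul, ← hα, ← hα, smul_smul, div_mul_cancel₀ _ hgv, sub_self])

/-- An unexceptional value, when `t` has rank two and few constraints concern `x`. -/
theorem exists_unexceptional_of_kerLineConstraints_eq_bot (hV : finrank K V = 4) (hb : b ≠ 0)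
    (hbt : ∀ u, b (t u) = 0) (hdim : finrank K T ≤ 2)
    (hrank : finrank K (LinearMap.range t) = 2) (htx : t x = 0)
    (hbot : kerLineConstraints T t b x = ⊥) {f : (V →ₗ[K] U) × K} (hf : f ∈ T) {w : V}
    (hw : b w = 0) (hfw : f.1 w ∉ span K {x}) :
    ∃ y, Adapted T t b x y ∧ Reducing T x y ∧ ¬ ExceptionalAt T t b x y := by
  obtain ⟨w₁, hw₁⟩ : ∃ w, b w = 1 := LinearMap.surjective hb 1
  let τ : ((V →ₗ[K] U) × K) →ₗ[K] V :=
    t.comp ((LinearMap.applyₗ w₁).comp (LinearMap.fst K (V →ₗ[K] U) K))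
  have hτ : ∀ p, τ p = t (p.1 w₁) := fun p => rfl
  have hlt : finrank K (lineConstraints T b x) < finrank K T :=
    Submodule.finrank_lt_finrank_of_lt (lt_of_le_of_ne (fun p hp => hp.1) fun h => hfw (by
      rw [← h] at hf
      exact hf.2 w hw))
  have hPdim : finrank K ((lineConstraints T b x).map τ) ≤ finrank K (lineConstraints T b x) :=
    Submodule.finrank_map_le _ _
  have hgood : ∀ z, b z = 0 → z ∉ (lineConstraints T b x).map τ → (∃ p ∈ T, p.1 z ∉ span K {x}) →
      Adapted T t b x z ∧ Reducing T x z := by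
    intro z hbz hzP hz
    refine ⟨⟨?_, hbz, fun p hp hpz => ?_⟩, Or.inr ⟨by omega, Or.inr hz⟩⟩
    · rintro rfl
      exact hzP (zero_mem _)
    · obtain ⟨s, hs⟩ := mem_span_singleton.1 (hpz w₁)
      have hs0 : s = 0 := by
        by_contra hs0
        refine hzP ⟨s⁻¹ • p, smul_mem _ _ hp, ?_⟩
        rw [map_smul, hτ, ← hs, smul_smul, inv_mul_cancel₀ hs0, one_smul]
      have hp2 : p ∈ kerLineConstraints T t b x := ⟨hp, fun v => by
        rw [apply_lineConstraint htx hw₁ hp, ← hs, hs0, zero_smul, smul_zero]⟩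
      rw [hbot] at hp2
      rw [show p = 0 from hp2]
      simp
  by_cases hcase : ∃ p ∈ T, ∃ u, p.1 (t u) ∉ span K {x}
  · obtain ⟨p, hp, u, hu⟩ := hcase
    obtain ⟨z, hzt, hzP, hpz⟩ : ∃ z ∈ LinearMap.range t, z ∉ (lineConstraints T b x).map τ ∧
        p.1 z ∉ span K {x} := by
      by_cases huP : t u ∈ (lineConstraints T b x).map τ
      · obtain ⟨z, hzt, hzP⟩ := exists_mem_notMem_of_finrank_lt (LinearMap.range t)
          ((lineConstraints T b x).map τ) (by omega)
        by_cases hpz : p.1 z ∈ span K {x}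
        · refine ⟨t u + z, add_mem ⟨u, rfl⟩ hzt,
            fun h => hzP ((Submodule.add_mem_iff_right _ huP).1 h), fun h => hu ?_⟩
          rw [map_add] at h
          exact (Submodule.add_mem_iff_left _ hpz).1 h
        · exact ⟨z, hzt, hzP, hpz⟩
      · exact ⟨t u, ⟨u, rfl⟩, huP, hu⟩
    have hbz : b z = 0 := by
      obtain ⟨u', rfl⟩ := hzt
      exact hbt u'
    obtain ⟨h1, h2⟩ := hgood z hbz hzP ⟨p, hp, hpz⟩
    refine ⟨z, h1, h2, fun hexc => ?_⟩
    have := hexc.three_le_finrank_range h1.1 hzt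
    omega
  · push Not at hcase
    obtain ⟨h1, h2⟩ := hgood w hw (by
      rintro ⟨p, -, rfl⟩
      exact hfw (hcase f hf _)) ⟨f, hf, hfw⟩
    refine ⟨w, h1, h2, ?_⟩
    rintro ⟨x₂, -, -, p, hp, -, -, -, -, ⟨u₂, hu₂⟩⟩
    exact hu₂ (hcase p hp u₂)

/-- If t x' = 0, then t has rank two, and x may have to be replaced by the range of a constraint or
by the value g w₁ of some g in `kerLineConstraints`. If t x' ≠ 0, then y lies in the range of t, so
t has rank three and its kernel is Kx. -/
theorem exists_unexceptional (hU : finrank K U = 4) (hV : finrank K V = 4)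
    (hK : ∀ s : K, s ≠ 0 → s = 1) (hb : b ≠ 0) (hbt : ∀ u, b (t u) = 0)
    (hT : Compatible T t b) (hdim : finrank K T ≤ 2) (hx : x ≠ 0) (htx : t x = 0)
    (hy : Adapted T t b x y) (hred : Reducing T x y) :
    ∃ x, x ≠ 0 ∧ t x = 0 ∧ ∃ y, Adapted T t b x y ∧ Reducing T x y ∧
      ¬ ExceptionalAt T t b x y := by
  by_cases hexc : ExceptionalAt T t b x y
  swap
  · exact ⟨x, hx, htx, y, hy, hred, hexc⟩
  have hrank := LinearMap.finrank_range_add_finrank_ker t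
  have hkerpos := finrank_pos_of_mem_ne_zero (show x ∈ LinearMap.ker t from htx) hx
  obtain ⟨x', hx', htx', f, hf, hfy, hfW, ⟨v, hv⟩, hfv, ⟨u, hu⟩⟩ := id hexc
  by_cases htx'0 : t x' = 0
  · have hker2 : 2 ≤ finrank K (LinearMap.ker t) :=
      two_le_finrank_of_pair (show x ∈ LinearMap.ker t from htx) htx'0
        (pair_independent_of_mem_notMem (mem_span_singleton_self x) hx hx')
    have hv0 : t (f.1 v) ≠ 0 := fun h => hv (by rw [h]; exact zero_mem _)
    have hrange2 : 2 ≤ finrank K (LinearMap.range t) := by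
      refine two_le_finrank_of_pair (e := t (f.1 v)) (f := t u) ⟨_, rfl⟩ ⟨_, rfl⟩
        (pair_independent_of_mem_notMem (mem_span_singleton_self _) hv0 fun h => hu ?_)
      obtain ⟨c, hc⟩ := mem_span_singleton.1 h
      rw [← hc, map_smul]
      exact smul_mem _ _ (hfv v)
    by_cases hA : ∃ x, x ≠ 0 ∧ t x = 0 ∧ rangeConstraints T x ≠ ⊥
    · obtain ⟨x₁, hx₁, htx₁, hA₁⟩ := hA
      obtain ⟨y₁, hy₁⟩ := (exists_adapted hb hbt hx₁ htx₁ hT (by omega)).1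
      by_cases hexc₁ : ExceptionalAt T t b x₁ y₁
      · exact ⟨x₁, hx₁, htx₁, exists_unexceptional_of_rank_two_of_range hV hbt hdim (by omega)
          hy₁ htx₁ hexc₁ hA₁⟩
      · exact ⟨x₁, hx₁, htx₁, y₁, hy₁, Or.inr ⟨by omega, Or.inl hA₁⟩, hexc₁⟩
    · push Not at hA
      by_cases hbot : kerLineConstraints T t b x = ⊥
      · exact ⟨x, hx, htx, exists_unexceptional_of_kerLineConstraints_eq_bot hV hb hbt hdim
          (by omega) htx hbot hf (hbt u) hu⟩
      · obtain ⟨g, hg, hg0⟩ := (Submodule.ne_bot_iff _).1 hbot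
        obtain ⟨w₁, hw₁⟩ : ∃ w, b w = 1 := LinearMap.surjective hb 1
        have hd : g.1 w₁ ∉ span K {x} := fun h => hg0 (by
          have := mem_rangeConstraints_of_lineConstraints hw₁ hg.1 h
          rw [hA x hx htx] at this
          exact this)
        have hd0 : g.1 w₁ ≠ 0 := fun h => hd (by rw [h]; exact zero_mem _)
        have hgl : g ∉ lineConstraints T b (g.1 w₁) := fun h => hg0 (by
          have := mem_rangeConstraints_of_lineConstraints hw₁ h (mem_span_singleton_self _)
          rw [hA _ hd0 (hg.2 w₁)] at this
          exact this)
        have hbot' : kerLineConstraints T t b (g.1 w₁) = ⊥ := by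
          rw [eq_bot_iff]
          intro p hp
          obtain ⟨c, d, rfl⟩ := exists_eq_combination_of_finrank_le_two hdim hg.1.1 hf
            (pair_independent_of_mem_notMem hg hg0 fun h => hu (h.1.2 _ (hbt u))) hp.1.1
          have hd : d = 0 := by
            have h1 := hp.2 v
            rw [Prod.fst_add, Prod.smul_fst, Prod.smul_fst, LinearMap.add_apply,
              LinearMap.smul_apply, LinearMap.smul_apply, map_add, map_smul, map_smul, hg.2 v,
              smul_zero, zero_add] at h1
            exact (smul_eq_zero.1 h1).resolve_right hv0
          rw [hd, zero_smul, add_zero] at hp ⊢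
          by_cases hc : c = 0
          · rw [hc, zero_smul]
            exact zero_mem _
          · exact absurd ((Submodule.smul_mem_iff _ hc).1 hp.1) hgl
        have : ∃ w, b w = 0 ∧ g.1 w ∉ span K {g.1 w₁} := by
          by_contra! h
          exact hgl ⟨hg.1.1, h⟩
        obtain ⟨w, hw, hgw⟩ := this
        exact ⟨_, hd0, hg.2 w₁, exists_unexceptional_of_kerLineConstraints_eq_bot hV hb hbt hdim
          (by omega) (hg.2 w₁) hbot' hg.1.1 hw hgw⟩
  · have hyt : y ∈ LinearMap.range t := by
      obtain ⟨s, hs⟩ := mem_span_singleton.1 htx'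
      have hs0 : s ≠ 0 := by
        rintro rfl
        exact htx'0 (by rw [← hs, zero_smul])
      exact ⟨s⁻¹ • x', by rw [map_smul, ← hs, smul_smul, inv_mul_cancel₀ hs0, one_smul]⟩
    have hr3 := hexc.three_le_finrank_range hy.1 hyt
    have hker : ∀ u, t u = 0 → u ∈ span K {x} := by
      have hle : span K {x} ≤ LinearMap.ker t := by
        rw [span_singleton_le_iff_mem]
        exact htx
      have heq := Submodule.eq_of_le_of_finrank_le hle
        (by rw [finrank_span_singleton hx]; omega)
      intro u hu
      rw [heq]
      exact hu
    by_cases hrange : rangeConstraints T x = ⊥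
    · exact ⟨x, hx, htx, exists_unexceptional_of_corank_one hV hK hb hbt hdim htx hker hy hexc
        hrange⟩
    · exact ⟨x, hx, htx, exists_unexceptional_of_corank_one_of_range hV hb hbt hT hdim hx htx hker
        hy hexc hrange⟩

end DimensionFour

/-! ### The induction on the dimension -/

section Induction

universe u v w

variable {K : Type w} {U : Type u} {V : Type v} [Field K] [AddCommGroup U] [Module K U]
  [AddCommGroup V] [Module K V] [FiniteDimensional K U] [FiniteDimensional K V]
  {T : Submodule K ((V →ₗ[K] U) × K)} {t : U →ₗ[K] V} {b : V →ₗ[K] K} {x : U} {y : V}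

theorem exists_ker_ne_zero_of_form (hUV : finrank K U = finrank K V) (hb : b ≠ 0)
    (hbt : ∀ u, b (t u) = 0) : ∃ x, x ≠ 0 ∧ t x = 0 := by
  have h1 := LinearMap.finrank_range_add_finrank_ker t
  have h2 := finrank_ker_add_one b hb
  have h3 : finrank K (LinearMap.range t) ≤ finrank K (LinearMap.ker b) :=
    Submodule.finrank_mono (by
      rintro _ ⟨u, rfl⟩
      exact hbt u)
  obtain ⟨x, hx⟩ := Module.finrank_pos_iff_exists_ne_zero.1
    (by omega : 0 < finrank K (LinearMap.ker t))
  exact ⟨x, fun h => hx (Subtype.ext h), x.2⟩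

theorem lineSolvable_of_reducing {m : ℕ} (ih : SolvableInDim.{u, v, w} K m)
    (hU : finrank K U = m + 1) (hV : finrank K V = m + 1) (hb : b ≠ 0)
    (hbt : ∀ u, b (t u) = 0) (hT : Compatible T t b) (hdim : finrank K T + 2 ≤ m + 1)
    (hx : x ≠ 0) (htx : t x = 0) (hy : Adapted T t b x y) (hred : Reducing T x y) :
    LineSolvable T t := by
  by_cases h : m = 3 ∧ ∀ s : K, s ≠ 0 → s = 1
  · obtain ⟨rfl, hK⟩ := h
    obtain ⟨x', hx', htx', y', hy', hred', hexc⟩ :=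
      exists_unexceptional hU hV hK hb hbt hT (by omega) hx htx hy hred
    exact lineSolvable_of_adapted ih hU hV hb hbt hx' htx' hy' hred' fun _ _ => hexc
  · exact lineSolvable_of_adapted ih hU hV hb hbt hx htx hy hred
      fun hm hK => absurd ⟨hm, hK⟩ h

theorem lineSolvable_bot {m : ℕ} (hU : finrank K U = m + 1) (hV : finrank K V = m + 1)
    (hx : x ≠ 0) (htx : t x = 0) : LineSolvable ⊥ t := by
  obtain ⟨a, ha⟩ := exists_line_injective hU hV t x hx htx
  refine ⟨a, fun p hp => ?_, ha⟩
  rw [(Submodule.mem_bot K).1 hp, Prod.fst_zero, LinearMap.comp_zero, map_zero, Prod.snd_zero]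

theorem solvableInDim (K : Type w) [Field K] (n : ℕ) : SolvableInDim.{u, v, w} K n := by
  induction n using Nat.strong_induction_on with
  | _ n ih =>
  intro U V _ _ _ _ _ _ hU hV T t b hb hbt hT hdim hexc
  obtain ⟨x₀, hx₀, htx₀⟩ := exists_ker_ne_zero_of_form (hU.trans hV.symm) hb hbt
  obtain ⟨m, rfl⟩ : ∃ m, n = m + 2 := ⟨n - 2, by omega⟩
  by_cases hTbot : T = ⊥
  · subst hTbot
    exact lineSolvable_bot hU hV hx₀ htx₀
  have hadapted : ∀ b, b ≠ 0 → (∀ u, b (t u) = 0) → Compatible T t b → ∀ x, x ≠ 0 → t x = 0 → _ :=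
    fun b hb hbt hT x hx htx => exists_adapted hb hbt hx htx hT (by omega)
  have hsolve : ∀ b, b ≠ 0 → (∀ u, b (t u) = 0) → Compatible T t b → ∀ x, x ≠ 0 → t x = 0 →
      ∀ y, Adapted T t b x y → Reducing T x y → LineSolvable T t :=
    fun b hb hbt hT x hx htx y hy hred =>
      lineSolvable_of_reducing (ih (m + 1) (by omega)) hU hV hb hbt hT hdim hx htx hy hred
  by_contra hns
  -- In a counterexample no adapted pair is reducing, so `T` has full dimension n - 2 and no
  -- constraint has range in a line of ker t. The latter makes every form b compatible, which
  -- `stuck_structure` uses when it changes b.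
  have hfull : finrank K T = m := by
    by_contra hne
    obtain ⟨y, hy⟩ := (hadapted b hb hbt hT x₀ hx₀ htx₀).1
    exact hns (hsolve b hb hbt hT x₀ hx₀ htx₀ y hy (Or.inl (by omega)))
  have hA : ∀ x, x ≠ 0 → t x = 0 → rangeConstraints T x = ⊥ := by
    intro x hx htx
    by_contra hne
    obtain ⟨y, hy⟩ := (hadapted b hb hbt hT x hx htx).1
    exact hns (hsolve b hb hbt hT x hx htx y hy (Or.inr ⟨by omega, Or.inl hne⟩))
  have hcompat : ∀ b, b ≠ 0 → (∀ u, b (t u) = 0) → Compatible T t b := by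
    intro b hb _ p hp
    rw [cornerConstraints_eq_bot hA ⟨x₀, hx₀, htx₀⟩ hb] at hp
    rw [(Submodule.mem_bot K).1 hp, Prod.snd_zero]
  have hstuck : ∀ b, b ≠ 0 → (∀ u, b (t u) = 0) → ∀ x, x ≠ 0 → t x = 0 →
      (∃ y, Admissible T t b x y) ∧
        ∀ y, Admissible T t b x y → ∀ p ∈ T, p.1 y ∈ span K {x} := by
    intro b hb hbt x hx htx
    obtain ⟨⟨y, hy⟩, hsel⟩ := hadapted b hb hbt (hcompat b hb hbt) x hx htx
    refine ⟨⟨y, hy.admissible⟩, fun y hy p hp => hsel ((span K {x}).comap p.1) (fun y hy => ?_) y hy⟩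
    by_contra hne
    exact hns (hsolve b hb hbt (hcompat b hb hbt) x hx htx y hy
      (Or.inr ⟨by omega, Or.inr ⟨p, hp, hne⟩⟩))
  by_cases hk : 2 ≤ finrank K (LinearMap.ker t)
  · exact hns (lineSolvable_of_stuck (ih m (by omega)) hU hV hA hstuck hk hTbot hfull hb hbt)
  have hker : ∀ u, t u = 0 ↔ u ∈ span K {x₀} := by
    have hle : span K {x₀} ≤ LinearMap.ker t := by
      rw [span_singleton_le_iff_mem]
      exact htx₀
    have heq := Submodule.eq_of_le_of_finrank_le hle
      (by rw [finrank_span_singleton hx₀]; omega)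
    intro u
    rw [heq]
    exact Iff.rfl
  obtain ⟨w₁, hw₁⟩ : ∃ w, b w = 1 := LinearMap.surjective hb 1
  refine hns (lineSolvable_of_stuck_of_corank_one (hU.trans hV.symm) hb hbt hx₀ hker
    (fun p hp w hw => (hstuck b hb hbt x₀ hx₀ htx₀).2 w ⟨hw, fun q hq => ?_⟩ p hp)
    (hA x₀ hx₀ htx₀) (by omega) hTbot (by rwa [hV]))
  have hq' := mem_rangeConstraints_of_lineConstraints hw₁ hq.1 ((hker _).1 (hq.2 w₁))
  rw [hA x₀ hx₀ htx₀] at hq'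
  rw [(Submodule.mem_bot K).1 hq']
  simp

end Induction

/-! ### From subspaces of operators to trace constraints -/

section Operators

universe u v w

variable {K : Type w} {U : Type u} {V : Type v} [Field K] [AddCommGroup U] [Module K U]
  [AddCommGroup V] [Module K V]

theorem codim_comap_le {E F : Type*} [AddCommGroup E] [Module K E] [AddCommGroup F] [Module K F]
    [FiniteDimensional K F] (S : Submodule K F) (f : E →ₗ[K] F) :
    codim K (S.comap f) ≤ codim K S := by
  refine LinearMap.finrank_le_finrank_of_injective (f := (S.comap f).mapQ S f le_rfl) ?_
  rw [← LinearMap.ker_eq_bot, Submodule.ker_mapQ]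
  exact Submodule.mkQ_map_self _

variable (K U V) in
/-- The trace pairing between operators in opposite directions. -/
noncomputable def tracePairing : (V →ₗ[K] U) →ₗ[K] Dual K (U →ₗ[K] V) where
  toFun f := (LinearMap.trace K V).comp (LinearMap.lcomp K V f)
  map_add' f g := by
    ext a
    change LinearMap.trace K V (a ∘ₗ (f + g)) =
      LinearMap.trace K V (a ∘ₗ f) + LinearMap.trace K V (a ∘ₗ g)
    rw [LinearMap.comp_add, map_add]
  map_smul' c f := by
    ext a
    change LinearMap.trace K V (a ∘ₗ (c • f)) = c • LinearMap.trace K V (a ∘ₗ f)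
    rw [LinearMap.comp_smul, map_smul]

theorem tracePairing_apply (f : V →ₗ[K] U) (a : U →ₗ[K] V) :
    tracePairing K U V f a = LinearMap.trace K V (a ∘ₗ f) := rfl

variable [FiniteDimensional K U] [FiniteDimensional K V]

theorem tracePairing_injective : Function.Injective (tracePairing K U V) := by
  rw [← LinearMap.ker_eq_bot, LinearMap.ker_eq_bot']
  intro f hf
  ext v
  rw [LinearMap.zero_apply, ← Module.forall_dual_apply_eq_zero_iff K]
  intro φ
  have h := LinearMap.congr_fun hf (φ.smulRight v)
  rw [tracePairing_apply, show (φ.smulRight v) ∘ₗ f = (φ ∘ₗ f).smulRight v by ext; rfl,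
    LinearMap.trace_smulRight] at h
  exact h

theorem tracePairing_surjective : Function.Surjective (tracePairing K U V) :=
  (LinearMap.injective_iff_surjective_of_finrank_eq_finrank (by
    rw [Subspace.dual_finrank_eq, finrank_linearMap, finrank_linearMap, mul_comm])).1
    tracePairing_injective

theorem exists_mem_line_injective_of_finrank_eq (hUV : finrank K U = finrank K V)
    (S : Submodule K (U →ₗ[K] V)) (hS : codim K S + 2 ≤ finrank K V) (t : U →ₗ[K] V)
    (ht : ¬ Function.Injective t) : ∃ a ∈ S, ∀ c : K, Function.Injective (a + c • t) := by
  -- All values are 0, so compatibility and the exceptional condition hold trivially.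
  let T : Submodule K ((V →ₗ[K] U) × K) :=
    (S.dualAnnihilator.comap (tracePairing K U V)).map (LinearMap.inl K _ K)
  have hT0 : ∀ p ∈ T, p.2 = 0 := by
    rintro _ ⟨f, -, rfl⟩
    rfl
  have hT : finrank K T ≤ codim K S := by
    have h1 : finrank K T ≤ finrank K (S.dualAnnihilator.comap (tracePairing K U V)) :=
      Submodule.finrank_map_le _ _
    have h2 : finrank K (S.dualAnnihilator.comap (tracePairing K U V)) ≤
        finrank K S.dualAnnihilator :=
      LinearMap.finrank_le_finrank_of_injective
        (f := (tracePairing K U V).restrict fun f hf => hf) fun f g h =>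
          Subtype.ext (tracePairing_injective (congrArg Subtype.val h))
    have h3 := Subspace.finrank_add_finrank_dualAnnihilator_eq S
    have h4 := Submodule.finrank_quotient_add_finrank S
    unfold codim
    omega
  have hts : ¬ Function.Surjective t := fun h =>
    ht ((LinearMap.injective_iff_surjective_of_finrank_eq_finrank hUV).2 h)
  obtain ⟨v, hv⟩ : ∃ v, v ∉ LinearMap.range t := by
    by_contra! h
    exact hts fun v => h v
  obtain ⟨b, hbv, hbt⟩ := exists_form_ne_zero_of_notMem_range hv
  obtain ⟨a, ha, hinj⟩ := solvableInDim K (finrank K V) U V hUV rfl T t b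
    (by rintro rfl; exact hbv rfl) hbt (fun p hp => hT0 p hp.1) (by omega)
    fun _ _ _ _ _ p hp _ _ h => absurd (hT0 p hp.1) h
  refine ⟨a, ?_, hinj⟩
  rw [← Subspace.forall_mem_dualAnnihilator_apply_eq_zero_iff]
  intro φ hφ
  obtain ⟨f, rfl⟩ := tracePairing_surjective φ
  exact ha _ ⟨f, hφ, rfl⟩

/-- `U` is enlarged by a factor F to the dimension of V, and t is extended by zero on F. Operators
whose restriction to U lies in `S` have at most the same codimension, and restricting a solution to
U preserves injectivity. -/
theorem exists_mem_line_injective (hUV : finrank K U ≤ finrank K V)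
    (S : Submodule K (U →ₗ[K] V)) (hS : codim K S + 2 ≤ finrank K V) (t : U →ₗ[K] V)
    (ht : ¬ Function.Injective t) : ∃ a ∈ S, ∀ c : K, Function.Injective (a + c • t) := by
  let F := Fin (finrank K V - finrank K U) → K
  let i : U →ₗ[K] U × F := LinearMap.inl K U F
  have hi : Function.Injective i := LinearMap.inl_injective
  obtain ⟨a, ha, hinj⟩ := exists_mem_line_injective_of_finrank_eq (U := U × F)
    (by rw [finrank_prod, finrank_fin_fun]; omega) (S.comap (LinearMap.lcomp K V i))
    (le_trans (Nat.add_le_add_right (codim_comap_le S _) 2) hS) (t ∘ₗ LinearMap.fst K U F)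
    fun h => ht fun u u' huu => hi (h huu)
  exact ⟨a ∘ₗ i, ha, fun c u u' h => hi (hinj c h)⟩

end Operators

/-! ### Matrices, and optimality of the bound -/

section Matrices

variable {K : Type*} [Field K]

theorem rank_eq_iff_injective {n p : ℕ} (A : Matrix (Fin n) (Fin p) K) :
    A.rank = p ↔ Function.Injective (Matrix.toLin' A) := by
  have h := LinearMap.finrank_range_add_finrank_ker (Matrix.toLin' A)
  rw [finrank_fin_fun] at h
  have hr : A.rank = finrank K (LinearMap.range (Matrix.toLin' A)) := by
    rw [Matrix.rank, Matrix.toLin'_apply']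
  rw [← LinearMap.ker_eq_bot, ← Submodule.finrank_eq_zero, hr]
  omega

theorem exists_mem_line_rank {n p : ℕ} (hpn : p ≤ n)
    (S : Submodule K (Matrix (Fin n) (Fin p) K)) (hS : codim K S + 2 ≤ n)
    (N : Matrix (Fin n) (Fin p) K) (hN : N.rank < p) :
    ∃ A ∈ S, ∀ c : K, (A + c • N).rank = p := by
  let e : Matrix (Fin n) (Fin p) K ≃ₗ[K] ((Fin p → K) →ₗ[K] (Fin n → K)) := Matrix.toLin'
  obtain ⟨a, ha, h⟩ := exists_mem_line_injective (U := Fin p → K) (V := Fin n → K)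
    (by rwa [finrank_fin_fun, finrank_fin_fun]) (S.comap e.symm.toLinearMap)
    (by
      rw [finrank_fin_fun]
      exact le_trans (Nat.add_le_add_right (codim_comap_le S _) 2) hS) (e N)
    fun h => hN.ne ((rank_eq_iff_injective N).2 h)
  refine ⟨e.symm a, ha, fun c => (rank_eq_iff_injective _).2 ?_⟩
  have := h c
  rwa [← e.apply_symm_apply a, ← map_smul, ← map_add] at this

theorem rank_ne_of_col_eq_zero {n p : ℕ} (A : Matrix (Fin n) (Fin p) K) (j : Fin p)
    (h : ∀ i, A i j = 0) : A.rank ≠ p := by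
  rw [Ne, rank_eq_iff_injective]
  intro hinj
  have h1 : Pi.single j (1 : K) = 0 := hinj (by
    rw [map_zero, Matrix.toLin'_apply, Matrix.mulVec_single_one]
    exact funext h)
  simpa using congrFun h1 j

/-- `S` consists of the matrices whose first column vanishes below its top entry, and N is the unit
matrix at that entry: subtracting A 0 0 times N clears the column. The second column of N is zero,
hence rk N < p. -/
theorem exists_codim_eq_no_line {n p : ℕ} (hp : 2 ≤ p) (hpn : p ≤ n) :
    ∃ S : Submodule K (Matrix (Fin n) (Fin p) K), codim K S + 1 = n ∧
      ∃ N : Matrix (Fin n) (Fin p) K, N.rank < p ∧ ∀ A ∈ S, ∃ c : K, (A + c • N).rank ≠ p := by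
  obtain ⟨n, rfl⟩ : ∃ m, n = m + 1 := ⟨n - 1, by omega⟩
  obtain ⟨p, rfl⟩ : ∃ m, p = m + 2 := ⟨p - 2, by omega⟩
  let f : Matrix (Fin (n + 1)) (Fin (p + 2)) K →ₗ[K] (Fin n → K) :=
    { toFun := fun A i => A i.succ 0
      map_add' := fun _ _ => rfl
      map_smul' := fun _ _ => rfl }
  have hf : Function.Surjective f := fun g =>
    ⟨Matrix.of fun i _ => Fin.cases 0 g i, rfl⟩
  refine ⟨LinearMap.ker f, ?_, Matrix.single 0 0 1, ?_, fun A hA => ⟨-A 0 0, ?_⟩⟩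
  · rw [codim, (f.quotKerEquivOfSurjective hf).finrank_eq, finrank_fin_fun]
  · refine lt_of_le_of_ne ((Matrix.rank_le_card_width _).trans_eq (Fintype.card_fin _)) ?_
    exact rank_ne_of_col_eq_zero _ 1 fun i => by simp [Matrix.single]
  · refine rank_ne_of_col_eq_zero _ 0 fun i => ?_
    refine Fin.cases ?_ (fun i => ?_) i
    · simp
    · have : A i.succ 0 = 0 := congrFun hA i
      simp [this, Matrix.single, (Fin.succ_ne_zero i).symm]

end Matrices

theorem mainTheorem1 {K : Type*} [Field K] :
    -- matrix form
    (∀ n p : ℕ, 2 ≤ p → p ≤ n →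
      ∀ S : Submodule K (Matrix (Fin n) (Fin p) K), codim K S + 2 ≤ n →
      ∀ N : Matrix (Fin n) (Fin p) K, N.rank < p →
        ∃ A ∈ S, ∀ c : K, (A + c • N).rank = p) ∧
    -- operator form
    (∀ (U : Type*) (V : Type*) [AddCommGroup U] [Module K U] [FiniteDimensional K U]
        [AddCommGroup V] [Module K V] [FiniteDimensional K V],
      Module.finrank K U ≤ Module.finrank K V →
      ∀ S : Submodule K (U →ₗ[K] V), codim K S + 2 ≤ Module.finrank K V →
      ∀ t : U →ₗ[K] V, ¬ Function.Injective t →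
        ∃ a ∈ S, ∀ c : K, Function.Injective (a + c • t)) ∧
    -- optimality of the bound, for all sizes
    (∀ n p : ℕ, 2 ≤ p → p ≤ n →
      ∃ S : Submodule K (Matrix (Fin n) (Fin p) K), codim K S + 1 = n ∧
      ∃ N : Matrix (Fin n) (Fin p) K, N.rank < p ∧
        ∀ A ∈ S, ∃ c : K, (A + c • N).rank ≠ p) :=
  ⟨fun _ _ _ hpn S hS N hN => exists_mem_line_rank hpn S hS N hN,
    fun _ _ _ _ _ _ _ _ hUV S hS t ht => exists_mem_line_injective hUV S hS t ht,
    fun _ _ hp hpn => exists_codim_eq_no_line hp hpn⟩
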